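/- Let $X$ be a non-empty connected locally finite graph, possibly with loops and multiple edges. Each edge (also each loop) has two orientations $e,\check e$; write $e^-,e^+$ for the initial and terminal vertex of an oriented edge, and let $\deg(x)$ be the number of oriented edges $e$ with $e^-=x$ (so a loop counts twice). Write $e\to f$ if $f^-=e^+$ and $f\neq\check e$. A cycle is a sequence $e_0,\dots,e_{n-1}$ ($n\ge 1$) of distinct oriented edges with pairwise distinct initial vertices such that $e_{k-1}\to e_k$ for $k=1,\dots,n$, where $e_n=e_0$. Assume that - small cycles are dense in $X$: there is $R>0$ such that for every vertex $x$ the ball $B(x,R)$ of the graph metric contains a cycle; - there is $M<\infty$ with $2\le\deg(x)\le M$ for every vertex $x$. Let $q^{(n)}(x,y)$ be the probability that non-backtracking random walk started at the vertex $x$ is at $y$ after $n$ steps; this walk first traverses an oriented edge chosen uniformly among the $\deg(x)$ ones with initial vertex $x$, and after having traversed $e$ it next traverses an edge chosen uniformly among the $\deg(e^+)-1$ oriented edges $f$ with $e\to f$. The graph $X$ is called amenable if $\inf_F \mathrm{Area}(F)/\mathrm{Vol}(F)=0$, where $F$ runs over the non-empty finite sets of vertices, $\mathrm{Vol}(F)=\sum_{x\in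 F}\deg(x)$, and $\mathrm{Area}(F)$ is the number of (unoriented) edges with one endpoint in $F$ and the other outside $F$. Then $\rho(Q)=\limsup_{n\to\infty}q^{(n)}(x,y)^{1/n}$ does not depend on the vertices $x,y$, one has $0<\rho(Q)\le 1$, and $$X\text{ is amenable}\iff\rho(Q)=1 .$$ Equivalently, $X$ is non-amenable if and only if the probabilities $q^{(n)}(x,y)$ decay exponentially, that is, there is $a\in(0,1)$ such that for all vertices $x,y$ there is $C$ with $q^{(n)}(x,y)\le C\,a^n$ for all $n\ge 0$. -/

import Mathlib

open Filter

/-- A locally finite graph with vertex set `V`, possibly with loops and multiple edges, given by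
its type `E` of oriented edges. Every unoriented edge (also every loop) is a pair `{e, inv e}` of
two different oriented edges. -/
structure Multigraph (V : Type*) (E : Type*) where
  /-- the initial vertex `e⁻` of an oriented edge -/
  init : E → V
  /-- the oppositely oriented edge -/
  inv : E → E
  inv_inv : ∀ e, inv (inv e) = e
  inv_ne : ∀ e, inv e ≠ e
  locallyFinite : ∀ x, {e | init e = x}.Finite

namespace Multigraph

variable {V : Type*} {E : Type*} (G : Multigraph V E)

/-- The terminal vertex `e⁺` of an oriented edge. -/
def term (e : E) : V := G.init (G.inv e)

/-- The finite set of oriented edges with initial vertex `x`. -/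
noncomputable def star (x : V) : Finset E := (G.locallyFinite x).toFinset

/-- The degree of a vertex. A loop has two orientations, so it counts twice. -/
noncomputable def deg (x : V) : ℕ := (G.star x).card

/-- The simple graph obtained by forgetting loops and multiplicities; it has the same
connectedness and the same graph distance. -/
def toSimple : SimpleGraph V where
  Adj x y := x ≠ y ∧ ∃ e, G.init e = x ∧ G.term e = y
  symm := ⟨fun x y ⟨hne, e, hx, hy⟩ =>
    ⟨hne.symm, G.inv e, hy, by simpa [term, G.inv_inv] using hx⟩⟩
  loopless := ⟨fun _ h => h.1 rfl⟩

/-- Any two vertices are joined by a path, and there is at least one vertex. -/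
def Connected : Prop := G.toSimple.Connected

/-- The ball `B(x, R)` in the graph distance. -/
def ball (x : V) (R : ℕ) : Set V := {y | G.toSimple.edist y x ≤ (R : ℕ∞)}

/-- `e → f`: the edge `f` starts where `e` ends and is not the reversal of `e`. -/
def Follows (e f : E) : Prop := G.init f = G.term e ∧ f ≠ G.inv e

/-- `c 0, …, c (n - 1)` is a cycle of length `n ≥ 1`, closed up by `c n = c 0`: its initial
vertices are pairwise distinct (so its edges are distinct too), and each edge is followed by the
next one. A loop is a cycle of length `1`, a double edge gives cycles of length `2`. -/
def IsCycle (n : ℕ) (c : ℕ → E) : Prop :=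
  0 < n ∧ c n = c 0 ∧ Set.InjOn (fun k => G.init (c k)) (Set.Iio n) ∧
    ∀ k < n, G.Follows (c k) (c (k + 1))

/-- Small cycles are dense: for some `R > 0`, every ball of radius `R` contains a cycle. -/
def SmallCyclesDense : Prop :=
  ∃ R : ℕ, 0 < R ∧ ∀ x : V, ∃ (n : ℕ) (c : ℕ → E), G.IsCycle n c ∧
    ∀ k < n, G.init (c k) ∈ G.ball x R

open Classical in
/-- The transition matrix `q_E(e, f)` of non-backtracking walk on oriented edges. -/
noncomputable def edgeStep (e f : E) : ℝ :=
  if G.Follows e f then 1 / ((G.deg (G.term e) : ℝ) - 1) else 0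

open Classical in
/-- The entries `q_E^{(n)}(e, f)` of the `n`-th power of `edgeStep`. The sum in the matrix product
runs over the edges `g` that start where `e` ends; for all others `edgeStep e g = 0`. -/
noncomputable def edgeProb : ℕ → E → E → ℝ
  | 0, e, f => if e = f then 1 else 0
  | n + 1, e, f => ∑ g ∈ G.star (G.term e), G.edgeStep e g * edgeProb n g f

open Classical in
/-- `q^{(n)}(x, y)`: the probability that non-backtracking random walk started at the vertex `x`
is at `y` at the `n`-th step. The first edge `e` is chosen uniformly among the `deg x` oriented
edges that start at `x`; the remaining `n` of `n + 1` steps follow the edge chain, and the last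
edge traversed is one of the edges `inv f`, `f ∈ star y`, that end at `y`. -/
noncomputable def nbProb : ℕ → V → V → ℝ
  | 0, x, y => if x = y then 1 else 0
  | n + 1, x, y =>
      1 / (G.deg x : ℝ) * ∑ e ∈ G.star x, ∑ f ∈ G.star y, G.edgeProb n e (G.inv f)

/-- `limsup_n q^{(n)}(x, y)^{1/n}` (a bounded sequence of nonnegative reals). -/
noncomputable def nbRate (x y : V) : ℝ :=
  limsup (fun n : ℕ => G.nbProb n x y ^ (1 / (n : ℝ))) atTop

/-- `ρ` is the non-backtracking spectral radius `ρ(Q)`: the upper limits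
`limsup_n q^{(n)}(x, y)^{1/n}` have the value `ρ` for all vertices `x`, `y`. -/
def IsNBSpectralRadius (ρ : ℝ) : Prop := ∀ x y : V, G.nbRate x y = ρ

/-- The `n`-step non-backtracking transition probabilities decay exponentially. -/
def NBDecaysExponentially : Prop :=
  ∃ a : ℝ, 0 < a ∧ a < 1 ∧ ∀ x y : V, ∃ C : ℝ, ∀ n : ℕ, G.nbProb n x y ≤ C * a ^ n

/-- `Vol(F)`, the sum of the degrees. -/
noncomputable def vol (F : Finset V) : ℕ := ∑ x ∈ F, G.deg x

/-- `Area(F)`, the number of edges between `F` and its complement; each of them is counted once,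
through its orientation that leaves `F`. -/
noncomputable def area (F : Finset V) : ℕ := {e | G.init e ∈ F ∧ G.term e ∉ F}.ncard

/-- The isoperimetric constant, an infimum over the nonempty finite sets of vertices. -/
noncomputable def isoperimetricConstant : ℝ :=
  ⨅ F : {F : Finset V // F.Nonempty}, (G.area F.1 : ℝ) / (G.vol F.1 : ℝ)

/-- The isoperimetric constant is `0`. -/
def Amenable : Prop := G.isoperimetricConstant = 0

end Multigraph

/-!
The proof works with the chain `Q = edgeStep` on the oriented edges. It is doubly
stochastic but not reversible; instead, reversing paths shows that `Q^n(e, f̌) = Q^n(f, ě)`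
(`edgeProb_rev`), so that `Qⁿ` followed by the involution `e ↦ ě` is symmetric.

Density of small cycles enters through one fact: unless all degrees are `2`, there is `K` such that
from every edge `e` one reaches `ě` by a non-backtracking path of at most `K` steps
(`exists_reaches_inv`). One walks to a cycle nearby, goes around it and comes back; if `e` lies on
that cycle, one uses a vertex of degree at least `3` on the cycle to leave it and to return in the
opposite direction. Consequently the edge chain is irreducible, and exponential bounds carry over
between all pairs of edges and vertices, which makes `nbRate` constant and positive.

*Decay excludes amenability* (`not_amenable_of_expBounded`). If `Q^n(e, f) = O(rⁿ)` with `r < 1`,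
then a Green function `h > 0` satisfies `Q h ≤ t h` with `t < 1`. Turning around gives
`h(ě) ≥ ε h(e)`, hence the symmetric matrix `A(e, f) = Q^n(e, f̌)` satisfies `A h ≤ ε⁻¹ tⁿ h`, and by
the Schur test `∑ A(e, f) ≤ ε⁻¹ tⁿ |H|` for the sum over a finite set `H` of edges. For the edges
that start in `F` this sum is at least `Vol(F) - (n + 1) Area(F)`, so `Area(F) / Vol(F)` is bounded
below.

*Non-amenability implies decay* (`exists_expBounded_edgeProb`). Turning around transfers the
isoperimetric inequality from vertices to the directed graph `e → f`
(`exists_edge_isoperimetry`). The co-area inequality and the Cauchy-Schwarz inequality then bound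
the Dirichlet form from below by a multiple of `‖u‖²`; as `Q` is doubly stochastic, the Dirichlet
form is controlled by `‖u‖² - ⟨u, Q u⟩`. Thus the lazy operator `(I + Q) / 2` is a strict
contraction on nonnegative functions of finite support, and
`((I + Q) / 2)^{2n} ≥ binom(2n, n) 4⁻ⁿ Qⁿ` gives `Q^n(e, f) ≤ (2n + 1) qⁿ` with `q < 1`.

If all degrees are `2`, the graph is one finite cycle, which is amenable, and the walk is
deterministic after its first step.
-/

namespace Multigraph

variable {V : Type*} {E : Type*} (G : Multigraph V E)

/-! ### Non-backtracking paths and transition probabilities -/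

@[simp] lemma mem_star {x : V} {e : E} : e ∈ G.star x ↔ G.init e = x := by simp [star]

@[simp] lemma init_inv (e : E) : G.init (G.inv e) = G.term e := rfl

@[simp] lemma term_inv (e : E) : G.term (G.inv e) = G.init e := by simp [term, G.inv_inv]

@[simp] lemma inv_inv' (e : E) : G.inv (G.inv e) = e := G.inv_inv e

lemma inv_injective : Function.Injective G.inv := fun a b h => by
  simpa using congrArg G.inv h

variable {G}

lemma Follows.rev {e f : E} (h : G.Follows e f) : G.Follows (G.inv f) (G.inv e) :=
  ⟨by simp [h.1], fun he => h.2 (by simpa using he.symm)⟩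

variable (G) in
/-- `G.NBPath n e f`: there are edges `e = e₀ → e₁ → … → eₙ = f`. -/
inductive NBPath : ℕ → E → E → Prop
  | refl (e : E) : NBPath 0 e e
  | cons {n : ℕ} {e f g : E} : G.Follows e f → NBPath n f g → NBPath (n + 1) e g

lemma NBPath.trans {m n : ℕ} {e f g : E} (h : G.NBPath m e f) (h' : G.NBPath n f g) :
    G.NBPath (m + n) e g := by
  induction h with
  | refl e => simpa using h'
  | cons hs _ ih =>
    rw [Nat.add_right_comm]
    exact .cons hs (ih h')

lemma Follows.nbPath {e f : E} (h : G.Follows e f) : G.NBPath 1 e f := .cons h (.refl f)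

lemma NBPath.rev {n : ℕ} {e f : E} (h : G.NBPath n e f) : G.NBPath n (G.inv f) (G.inv e) := by
  induction h with
  | refl e => exact .refl _
  | cons hs _ ih => exact ih.trans hs.rev.nbPath

lemma NBPath.exists_pred {n : ℕ} {e f : E} (h : G.NBPath (n + 1) e f) :
    ∃ g, G.NBPath n e g ∧ G.Follows g f := by
  have h' := h.rev
  cases h' with
  | cons hs hp => exact ⟨_, by simpa using hp.rev, by simpa using hs.rev⟩

variable (G) in
/-- The averaging operator of the edge chain, `u ↦ (e ↦ ∑ g, q_E(e, g) u(g))`. -/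
noncomputable def act (u : E → ℝ) (e : E) : ℝ :=
  ∑ g ∈ G.star (G.term e), G.edgeStep e g * u g

lemma edgeProb_succ (n : ℕ) (e f : E) :
    G.edgeProb (n + 1) e f = G.act (fun g => G.edgeProb n g f) e := rfl

lemma edgeStep_of_follows {e f : E} (h : G.Follows e f) :
    G.edgeStep e f = 1 / ((G.deg (G.term e) : ℝ) - 1) := by simp [edgeStep, h]

lemma edgeStep_of_not {e f : E} (h : ¬ G.Follows e f) : G.edgeStep e f = 0 := by
  simp [edgeStep, h]

lemma edgeStep_rev (e f : E) : G.edgeStep (G.inv f) (G.inv e) = G.edgeStep e f := by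
  by_cases h : G.Follows e f
  · rw [edgeStep_of_follows h, edgeStep_of_follows h.rev, term_inv, h.1]
  · rw [edgeStep_of_not h, edgeStep_of_not fun h' => h (by simpa using h'.rev)]

section MinDegreeTwo

variable (hdeg : ∀ x : V, 2 ≤ G.deg x)
include hdeg

lemma edgeStep_nonneg (e f : E) : 0 ≤ G.edgeStep e f := by
  have := hdeg (G.term e)
  have h2 : (2 : ℝ) ≤ G.deg (G.term e) := by exact_mod_cast this
  unfold edgeStep
  split_ifs
  · exact one_div_nonneg.2 (by linarith)
  · exact le_rfl

lemma act_mono {u v : E → ℝ} (h : ∀ e, u e ≤ v e) (e : E) : G.act u e ≤ G.act v e :=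
  Finset.sum_le_sum fun g _ => mul_le_mul_of_nonneg_left (h g) (edgeStep_nonneg hdeg e g)

lemma act_one (e : E) : ∑ g ∈ G.star (G.term e), G.edgeStep e g = 1 := by
  classical
  have h2 : (2 : ℝ) ≤ G.deg (G.term e) := by exact_mod_cast hdeg (G.term e)
  have hm : G.inv e ∈ G.star (G.term e) := by simp
  rw [← Finset.add_sum_erase _ _ hm, edgeStep_of_not (fun h => h.2 rfl), zero_add,
    Finset.sum_congr rfl (g := fun _ => 1 / ((G.deg (G.term e) : ℝ) - 1)), Finset.sum_const,
    Finset.card_erase_of_mem hm, nsmul_eq_mul, Nat.cast_sub (Finset.card_pos.2 ⟨_, hm⟩)]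
  · change ((G.deg (G.term e) : ℝ) - (1 : ℕ)) * _ = 1
    rw [Nat.cast_one, mul_one_div_cancel]
    linarith
  · intro g hg
    simp only [Finset.mem_erase, mem_star] at hg
    exact edgeStep_of_follows ⟨hg.2, hg.1⟩

lemma exists_follows (e : E) : ∃ f, G.Follows e f := by
  classical
  obtain ⟨f, hf, hne⟩ := Finset.exists_mem_ne (s := G.star (G.term e))
    (lt_of_lt_of_le one_lt_two (hdeg _)) (G.inv e)
  exact ⟨f, by simpa using hf, hne⟩

lemma exists_nbPath (n : ℕ) (e : E) : ∃ f, G.NBPath n e f := by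
  induction n generalizing e with
  | zero => exact ⟨e, .refl e⟩
  | succ n ih =>
    obtain ⟨f, hf⟩ := exists_follows hdeg e
    obtain ⟨g, hg⟩ := ih f
    exact ⟨g, .cons hf hg⟩

lemma edgeProb_nonneg (n : ℕ) (e f : E) : 0 ≤ G.edgeProb n e f := by
  induction n generalizing e with
  | zero => unfold edgeProb; split_ifs <;> norm_num
  | succ n ih => exact Finset.sum_nonneg fun g _ => mul_nonneg (edgeStep_nonneg hdeg e g) (ih g)

lemma edgeProb_mul_le (m n : ℕ) (e f g : E) :
    G.edgeProb m e f * G.edgeProb n f g ≤ G.edgeProb (m + n) e g := by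
  induction m generalizing e with
  | zero =>
    by_cases h : e = f
    · subst h; simp [edgeProb]
    · simpa [edgeProb, h] using edgeProb_nonneg hdeg n e g
  | succ m ih =>
    rw [Nat.add_right_comm, edgeProb, edgeProb, Finset.sum_mul]
    refine Finset.sum_le_sum fun k _ => ?_
    rw [mul_assoc]
    exact mul_le_mul_of_nonneg_left (ih k) (edgeStep_nonneg hdeg e k)

/-- A function `h` with `Q h ≤ r h` satisfies `Qⁿ h ≤ rⁿ h`. -/
lemma sum_edgeProb_mul_le {h : E → ℝ} {r : ℝ} (hr : 0 ≤ r) (h0 : ∀ e, 0 ≤ h e)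
    (hh : ∀ e, G.act h e ≤ r * h e) (n : ℕ) (H : Finset E) (e : E) :
    ∑ g ∈ H, G.edgeProb n e g * h g ≤ r ^ n * h e := by
  classical
  induction n generalizing e with
  | zero =>
    simp only [edgeProb, ite_mul, one_mul, zero_mul, Finset.sum_ite_eq, pow_zero]
    split_ifs
    · exact le_rfl
    · exact h0 e
  | succ n ih =>
    calc ∑ g ∈ H, G.edgeProb (n + 1) e g * h g
        = G.act (fun k => ∑ g ∈ H, G.edgeProb n k g * h g) e := by
          simp only [edgeProb, act, Finset.sum_mul, Finset.mul_sum]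
          rw [Finset.sum_comm]
          simp only [mul_assoc]
      _ ≤ G.act (fun k => r ^ n * h k) e := act_mono hdeg ih e
      _ = r ^ n * G.act h e := by
          simp only [act, Finset.mul_sum]
          exact Finset.sum_congr rfl fun _ _ => by ring
      _ ≤ r ^ n * (r * h e) := mul_le_mul_of_nonneg_left (hh e) (pow_nonneg hr n)
      _ = r ^ (n + 1) * h e := by ring

lemma sum_edgeProb_le_one (n : ℕ) (H : Finset E) (e : E) : ∑ g ∈ H, G.edgeProb n e g ≤ 1 := by
  simpa using sum_edgeProb_mul_le hdeg (h := fun _ => 1) (r := 1) zero_le_one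
    (fun _ => zero_le_one) (fun e => by simp [act, act_one hdeg]) n H e

lemma edgeProb_pos {n : ℕ} {e f : E} (h : G.NBPath n e f) : 0 < G.edgeProb n e f := by
  induction h with
  | refl e => simp [edgeProb]
  | @cons n e f g hs _ ih =>
    have h2 : (2 : ℝ) ≤ G.deg (G.term e) := by exact_mod_cast hdeg (G.term e)
    have h1 : 0 < G.edgeStep e f := by
      rw [edgeStep_of_follows hs]
      exact one_div_pos.2 (by linarith)
    refine lt_of_lt_of_le (mul_pos h1 ih) ?_
    exact Finset.single_le_sum (f := fun k => G.edgeStep e k * G.edgeProb n k g)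
      (fun k _ => mul_nonneg (edgeStep_nonneg hdeg e k) (edgeProb_nonneg hdeg n k g))
      (G.mem_star.2 hs.1)

omit hdeg in
lemma one_div_le_edgeStep {M : ℕ} (hM : ∀ x, 2 ≤ G.deg x ∧ G.deg x ≤ M) {e f : E}
    (h : G.Follows e f) : 1 / (M : ℝ) ≤ G.edgeStep e f := by
  have h2 : (2 : ℝ) ≤ G.deg (G.term e) := by exact_mod_cast (hM (G.term e)).1
  have h3 : (G.deg (G.term e) : ℝ) ≤ M := by exact_mod_cast (hM (G.term e)).2
  rw [edgeStep_of_follows h]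
  exact one_div_le_one_div_of_le (by linarith) (by linarith)

omit hdeg in
lemma pow_le_edgeProb {M : ℕ} (hM : ∀ x, 2 ≤ G.deg x ∧ G.deg x ≤ M) {n : ℕ} {e f : E}
    (h : G.NBPath n e f) : (1 / (M : ℝ)) ^ n ≤ G.edgeProb n e f := by
  have hd := fun x => (hM x).1
  induction h with
  | refl e => simp [edgeProb]
  | @cons n e f g hs _ ih =>
    rw [pow_succ']
    refine (mul_le_mul (one_div_le_edgeStep hM hs) ih (by positivity)
      (edgeStep_nonneg hd e f)).trans ?_
    exact Finset.single_le_sum (f := fun k => G.edgeStep e k * G.edgeProb n k g)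
      (fun k _ => mul_nonneg (edgeStep_nonneg hd e k) (edgeProb_nonneg hd n k g))
      (G.mem_star.2 hs.1)

omit hdeg in
/-- The matrix power computed by splitting off the last instead of the first step. -/
lemma edgeProb_succ_right (n : ℕ) (e f : E) : G.edgeProb (n + 1) e f =
    ∑ k ∈ G.star (G.init f), G.edgeProb n e (G.inv k) * G.edgeStep (G.inv k) f := by
  classical
  induction n generalizing e with
  | zero =>
    have h1 : ∀ k, (e = G.inv k) = (G.inv e = k) := fun k => by
      apply propext; constructor <;> rintro rfl <;> simp
    simp only [edgeProb, mul_ite, mul_one, mul_zero, ite_mul, one_mul, zero_mul,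
      Finset.sum_ite_eq', mem_star, h1, Finset.sum_ite_eq, init_inv, inv_inv']
    rw [eq_comm (a := G.term e)]
  | succ n ih =>
    rw [edgeProb_succ, funext ih]
    simp only [act, Finset.mul_sum, edgeProb, Finset.sum_mul]
    rw [Finset.sum_comm]
    simp only [mul_assoc]

omit hdeg in
/-- Reversing paths preserves their probabilities; equivalently, the product of the `n`-step
matrix with the involution `e ↦ ě` is a symmetric matrix. -/
lemma edgeProb_rev (n : ℕ) (e f : E) :
    G.edgeProb n e (G.inv f) = G.edgeProb n f (G.inv e) := by
  induction n generalizing e with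
  | zero =>
    have h1 : (e = G.inv f) ↔ (f = G.inv e) := by constructor <;> rintro rfl <;> simp
    by_cases h : e = G.inv f
    · simp [edgeProb, h]
    · simp [edgeProb, h, mt h1.2 h]
  | succ n ih =>
    rw [edgeProb_succ_right n f, edgeProb, init_inv]
    refine Finset.sum_congr rfl fun k _ => ?_
    rw [ih k, edgeStep_rev, mul_comm]

lemma sum_edgeProb_col_le_one (n : ℕ) (H : Finset E) (g : E) :
    ∑ e ∈ H, G.edgeProb n e g ≤ 1 := by
  classical
  have h := sum_edgeProb_le_one hdeg n (H.image G.inv) (G.inv g)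
  rw [Finset.sum_image fun a _ b _ h => G.inv_injective h] at h
  simpa only [edgeProb_rev n (G.inv g), inv_inv'] using h

lemma nbProb_nonneg (n : ℕ) (x y : V) : 0 ≤ G.nbProb n x y := by
  cases n with
  | zero => rw [nbProb]; split_ifs <;> norm_num
  | succ n =>
    exact mul_nonneg (by positivity)
      (Finset.sum_nonneg fun e _ => Finset.sum_nonneg fun f _ => edgeProb_nonneg hdeg n e _)

lemma nbProb_le_one (n : ℕ) (x y : V) : G.nbProb n x y ≤ 1 := by
  classical
  cases n with
  | zero => rw [nbProb]; split_ifs <;> norm_num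
  | succ n =>
    have h2 : (2 : ℝ) ≤ G.deg x := by exact_mod_cast hdeg x
    have h : ∑ e ∈ G.star x, ∑ f ∈ G.star y, G.edgeProb n e (G.inv f) ≤ G.deg x := by
      refine (Finset.sum_le_card_nsmul _ _ 1 fun e _ => ?_).trans (by simp [deg])
      have h := sum_edgeProb_le_one hdeg n ((G.star y).image G.inv) e
      rwa [Finset.sum_image fun a _ b _ h => G.inv_injective h] at h
    rw [nbProb, one_div_mul_eq_div, div_le_one (by linarith)]
    exact h

lemma edgeProb_le_nbProb (n : ℕ) {x y : V} {e f : E} (he : G.init e = x) (hf : G.init f = y) :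
    G.edgeProb n e (G.inv f) ≤ G.deg x * G.nbProb (n + 1) x y := by
  have h2 : (2 : ℝ) ≤ G.deg x := by exact_mod_cast hdeg x
  rw [nbProb, ← mul_assoc, mul_one_div_cancel (by linarith), one_mul]
  refine le_trans ?_ (Finset.single_le_sum
    (f := fun e => ∑ f ∈ G.star y, G.edgeProb n e (G.inv f))
    (fun k _ => Finset.sum_nonneg fun f _ => edgeProb_nonneg hdeg n k _) (G.mem_star.2 he))
  exact Finset.single_le_sum (f := fun f => G.edgeProb n e (G.inv f))
    (fun k _ => edgeProb_nonneg hdeg n e _) (G.mem_star.2 hf)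

end MinDegreeTwo

/-! ### Neighbourhoods in the graph distance -/

open Classical in
variable (G) in
/-- The vertices that can be reached from `x` by crossing at most `k` edges. -/
noncomputable def nbhd : ℕ → V → Finset V
  | 0, x => {x}
  | k + 1, x => nbhd k x ∪ (nbhd k x).biUnion fun y => (G.star y).image G.term

lemma card_nbhd_le {M : ℕ} (hM : ∀ x, G.deg x ≤ M) (k : ℕ) (x : V) :
    (G.nbhd k x).card ≤ (M + 1) ^ k := by
  classical
  induction k with
  | zero => simp [nbhd]
  | succ k ih =>
    rw [nbhd]
    refine (Finset.card_union_le _ _).trans ?_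
    have h := Finset.card_biUnion_le_card_mul (G.nbhd k x)
      (fun y => (G.star y).image G.term) M fun y _ => Finset.card_image_le.trans (hM y)
    calc _ ≤ (G.nbhd k x).card + (G.nbhd k x).card * M := Nat.add_le_add_left (by convert h) _
      _ = (G.nbhd k x).card * (M + 1) := by ring
      _ ≤ _ := by rw [pow_succ]; exact Nat.mul_le_mul_right _ ih

lemma nbhd_mono {j k : ℕ} (h : j ≤ k) (x : V) : G.nbhd j x ⊆ G.nbhd k x := by
  classical
  induction h with
  | refl => exact subset_rfl
  | step _ ih =>
    rw [nbhd]
    exact ih.trans Finset.subset_union_left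

lemma init_mem_nbhd_succ {k : ℕ} {x : V} {e : E} (h : G.term e ∈ G.nbhd k x) :
    G.init e ∈ G.nbhd (k + 1) x := by
  classical
  rw [nbhd]
  refine Finset.mem_union_right _ (Finset.mem_biUnion.2 ⟨_, h, Finset.mem_image.2 ⟨G.inv e, ?_⟩⟩)
  simp

lemma mem_nbhd_of_walk {x y : V} (p : G.toSimple.Walk y x) : y ∈ G.nbhd p.length x := by
  induction p with
  | nil => simp [nbhd]
  | cons h p ih =>
    obtain ⟨-, e, he, hf⟩ := h
    subst he hf
    exact init_mem_nbhd_succ ih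

lemma exists_walk_of_mem_ball {x y : V} {R : ℕ} (h : y ∈ G.ball x R) :
    ∃ p : G.toSimple.Walk y x, p.length ≤ R := by
  have h1 : G.toSimple.edist y x ≠ ⊤ := ne_top_of_le_ne_top (ENat.natCast_ne_top R) h
  obtain ⟨p, hp⟩ := SimpleGraph.exists_walk_of_edist_ne_top h1
  refine ⟨p, ?_⟩
  have h2 : (p.length : ℕ∞) ≤ R := hp.trans_le h
  exact_mod_cast h2

lemma NBPath.init_mem_nbhd {n : ℕ} {e f : E} (h : G.NBPath n e f) :
    G.init e ∈ G.nbhd n (G.init f) := by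
  induction h with
  | refl e => simp [nbhd]
  | cons hs _ ih => exact init_mem_nbhd_succ (hs.1 ▸ ih)

/-! ### Periodic cycles -/

variable (G) in
/-- A cycle, run through periodically. -/
structure PeriodicCycle (n : ℕ) (c : ℕ → E) : Prop where
  pos : 0 < n
  periodic : ∀ k, c (k + n) = c k
  inj : ∀ i j, G.init (c i) = G.init (c j) → c i = c j
  follows : ∀ k, G.Follows (c k) (c (k + 1))

lemma IsCycle.periodicCycle {n : ℕ} {c : ℕ → E} (h : G.IsCycle n c) :
    G.PeriodicCycle n (fun k => c (k % n)) := by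
  obtain ⟨h0, h1, h2, h3⟩ := h
  refine ⟨h0, fun k => by simp, fun i j hij => ?_, fun k => ?_⟩
  · exact congrArg c (h2 (Nat.mod_lt i h0) (Nat.mod_lt j h0) hij)
  · have hk := Nat.mod_lt k h0
    have h4 := h3 _ hk
    have h5 : c ((k + 1) % n) = c (k % n + 1) := by
      rcases Nat.lt_or_ge (k % n + 1) n with hlt | hge
      · rw [Nat.add_mod, Nat.mod_eq_of_lt (b := n) (a := 1) (by omega), Nat.mod_eq_of_lt hlt]
      · have h6 : k % n + 1 = n := by omega
        rw [h6, h1, ← Nat.mod_add_mod, h6, Nat.mod_self]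
    simpa only [h5] using h4

variable (G) in
/-- `f` can be reached from `e` by a non-backtracking path of at most `K` steps. -/
def Reaches (K : ℕ) (e f : E) : Prop := ∃ m ≤ K, G.NBPath m e f

lemma Reaches.trans {K L : ℕ} {e f g : E} (h : G.Reaches K e f) (h' : G.Reaches L f g) :
    G.Reaches (K + L) e g := by
  obtain ⟨m, hm, p⟩ := h
  obtain ⟨n, hn, q⟩ := h'
  exact ⟨m + n, by omega, p.trans q⟩

lemma Reaches.rev {K : ℕ} {e f : E} (h : G.Reaches K e f) :
    G.Reaches K (G.inv f) (G.inv e) := by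
  obtain ⟨m, hm, p⟩ := h
  exact ⟨m, hm, p.rev⟩

lemma Reaches.mono {K L : ℕ} (h : K ≤ L) {e f : E} (h' : G.Reaches K e f) : G.Reaches L e f := by
  obtain ⟨m, hm, p⟩ := h'
  exact ⟨m, hm.trans h, p⟩

lemma Follows.reaches {e f : E} (h : G.Follows e f) : G.Reaches 1 e f := ⟨1, le_rfl, h.nbPath⟩

namespace PeriodicCycle

variable {n : ℕ} {c : ℕ → E}

lemma init_succ (h : G.PeriodicCycle n c) (k : ℕ) : G.init (c (k + 1)) = G.term (c k) :=
  (h.follows k).1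

lemma exists_pred (h : G.PeriodicCycle n c) (k : ℕ) : ∃ j, c (j + 1) = c k := by
  have := h.pos
  exact ⟨k + n - 1, by rw [← h.periodic k]; congr 1; omega⟩

lemma reaches (h : G.PeriodicCycle n c) (k j : ℕ) : G.Reaches n (c k) (c j) := by
  have hp : Function.Periodic c n := h.periodic
  have walk : ∀ m, G.NBPath m (c k) (c (k + m)) := fun m => by
    induction m with
    | zero => exact .refl _
    | succ m ih => exact ih.trans (h.follows _).nbPath
  refine ⟨(j + (n - 1) * k) % n, (Nat.mod_lt _ h.pos).le, ?_⟩
  convert walk _ using 1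
  have h1 : k + (j + (n - 1) * k) = j + n * k := by
    obtain ⟨m, rfl⟩ := Nat.exists_eq_succ_of_ne_zero h.pos.ne'
    simp only [Nat.succ_eq_add_one, Nat.add_sub_cancel]
    ring
  rw [← hp.map_mod_nat j, ← hp.map_mod_nat (k + _), Nat.add_mod_mod, h1, Nat.add_mul_mod_self_left]

/-- If all vertices of a cycle have degree `2`, there are no other vertices. -/
lemma exists_eq_init (h : G.PeriodicCycle n c) (hconn : G.Connected)
    (h2 : ∀ k, G.deg (G.init (c k)) ≤ 2) (x : V) : ∃ k, x = G.init (c k) := by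
  classical
  have key : ∀ {y z : V} (p : G.toSimple.Walk y z), (∃ k, y = G.init (c k)) →
      ∃ k, z = G.init (c k) := by
    intro y z p
    induction p with
    | nil => exact id
    | cons hadj p ih =>
      rintro ⟨k, hk⟩
      apply ih
      obtain ⟨-, e, he, rfl⟩ := hadj
      obtain ⟨j, hj⟩ := h.exists_pred k
      have hf := h.follows j
      rw [hj] at hf
      have hsub : ({c k, G.inv (c j)} : Finset E) ⊆ G.star (G.init (c k)) := by
        intro a ha
        simp only [Finset.mem_insert, Finset.mem_singleton] at ha
        rcases ha with rfl | rfl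
        · simp
        · simp [hf.1]
      have heq := Finset.eq_of_subset_of_card_le hsub
        ((h2 k).trans (Finset.card_pair hf.2).ge)
      have hmem : e ∈ G.star (G.init (c k)) := by simp [he, hk]
      rw [← heq] at hmem
      simp only [Finset.mem_insert, Finset.mem_singleton] at hmem
      rcases hmem with rfl | rfl
      · exact ⟨k + 1, (h.init_succ k).symm⟩
      · exact ⟨j, by simp⟩
  obtain ⟨p⟩ := hconn.preconnected (G.init (c 0)) x
  exact key p ⟨0, rfl⟩

end PeriodicCycle

/-! ### Turning around -/

/-- Follow a non-backtracking path and then a walk of at most as many steps; cancelling the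
backtracking leaves a non-backtracking path with the same first edge. -/
lemma NBPath.exists_append {x v : V} (p : G.toSimple.Walk x v) {m : ℕ} {e a : E}
    (h : G.NBPath m e a) (hm : p.length ≤ m) (hx : x = G.term a) :
    ∃ f, G.Reaches (m + p.length) e f ∧ G.term f = v := by
  induction p generalizing m a with
  | nil => exact ⟨a, ⟨m, le_rfl, h⟩, hx.symm⟩
  | cons hadj p ih =>
    obtain ⟨b, hb, hy⟩ := hadj.2
    rw [SimpleGraph.Walk.length_cons] at hm ⊢
    by_cases hba : b = G.inv a
    · obtain ⟨m, rfl⟩ := Nat.exists_eq_succ_of_ne_zero (show m ≠ 0 by omega)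
      obtain ⟨a', h', hs⟩ := h.exists_pred
      obtain ⟨f, hf, hv⟩ := ih h' (by omega) (by rw [← hy, hba, term_inv, hs.1])
      exact ⟨f, hf.mono (by omega), hv⟩
    · obtain ⟨f, hf, hv⟩ := ih (h.trans (Follows.nbPath ⟨hb.trans hx, hba⟩)) (by omega) hy.symm
      exact ⟨f, hf.mono (by omega), hv⟩

/-- Stop a path when it arrives at `S` for the first time: its last edge then starts outside `S`,
unless it is the first edge. -/
lemma Reaches.exists_first_hit {K : ℕ} {e f : E} (h : G.Reaches K e f) (S : Set V)
    (hf : G.term f ∈ S) :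
    ∃ g, G.Reaches K e g ∧ G.term g ∈ S ∧ (g = e ∨ G.init g ∉ S) := by
  obtain ⟨m, hm, p⟩ := h
  suffices h : ∃ g, G.Reaches m e g ∧ G.term g ∈ S ∧ (g = e ∨ G.init g ∉ S) by
    obtain ⟨g, hg, h'⟩ := h
    exact ⟨g, hg.mono hm, h'⟩
  clear hm
  induction p with
  | refl e => exact ⟨e, ⟨0, le_rfl, .refl e⟩, hf, .inl rfl⟩
  | @cons m e f k hs p ih =>
    by_cases he : G.term e ∈ S
    · exact ⟨e, ⟨0, Nat.zero_le _, .refl e⟩, he, .inl rfl⟩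
    · obtain ⟨g, hg, hgS, h⟩ := ih hf
      refine ⟨g, (hs.reaches.trans hg).mono (by omega), hgS, .inr ?_⟩
      rcases h with rfl | h
      · rwa [hs.1]
      · exact h

section TurnAround

variable {N R : ℕ} (hdeg : ∀ x : V, 2 ≤ G.deg x)
  (hcyc : ∀ x : V, ∃ n ≤ N, ∃ c, G.PeriodicCycle n c ∧ ∀ k, G.init (c k) ∈ G.ball x R)
include hdeg hcyc

/-- From every edge one can turn around at a small cycle, unless the edge lies on that cycle. -/
lemma reaches_inv_or_mem_cycle (e : E) :
    G.Reaches (4 * R + N + 2) e (G.inv e) ∨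
      ∃ n ≤ N, ∃ c, G.PeriodicCycle n c ∧ ∃ k, e = c k ∨ e = G.inv (c k) := by
  obtain ⟨a, ha⟩ := exists_nbPath hdeg R e
  obtain ⟨n, hn, c, hc, hball⟩ := hcyc (G.term a)
  obtain ⟨p, hp⟩ := exists_walk_of_mem_ball (hball 0)
  obtain ⟨f, hf, hfv⟩ := ha.exists_append p.reverse (by simpa using hp) rfl
  obtain ⟨g, hg, hgS, hge⟩ := hf.exists_first_hit {v | ∃ k, v = G.init (c k)} ⟨0, hfv⟩
  by_cases hgc : ∃ k, g = c k ∨ g = G.inv (c k)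
  · right
    refine ⟨n, hn, c, hc, ?_⟩
    rcases hge with rfl | hge
    · exact hgc
    · obtain ⟨k, rfl | rfl⟩ := hgc
      · exact absurd ⟨k, rfl⟩ hge
      · exact absurd ⟨k + 1, by simp [hc.init_succ]⟩ hge
  · left
    push Not at hgc
    obtain ⟨k, hk⟩ := hgS
    obtain ⟨j, hj⟩ := hc.exists_pred k
    have h1 : G.Follows g (c k) := ⟨hk.symm, fun h => (hgc k).2 (by simp [h])⟩
    have h2 : G.Follows (c j) (G.inv g) := by
      refine ⟨by rw [init_inv, hk, ← hj, hc.init_succ], fun h => (hgc j).1 (G.inv_injective h)⟩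
    have hlen : p.reverse.length = p.length := p.length_reverse
    exact (((hg.trans h1.reaches).trans (hc.reaches k j)).trans
      (h2.reaches.trans hg.rev)).mono (by omega)

lemma exists_reaches_term_eq (e : E) :
    ∃ g, G.Reaches (4 * R + N + 2) e g ∧ G.term g = G.init e := by
  rcases reaches_inv_or_mem_cycle hdeg hcyc e with h | ⟨n, hn, c, hc, k, rfl | rfl⟩
  · exact ⟨_, h, by simp⟩
  · obtain ⟨j, hj⟩ := hc.exists_pred k
    exact ⟨c j, (hc.reaches k j).mono (by omega), by rw [← hj, hc.init_succ]⟩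
  · exact ⟨G.inv (c (k + 1)), (hc.reaches (k + 1) k).rev.mono (by omega), by
      simp [hc.init_succ]⟩

/-- From every edge one can turn around within a bounded number of steps. If the edge lies on a
cycle, one leaves the cycle at a vertex of degree at least `3`, follows a path that returns to it
and then runs through the cycle in the opposite direction. -/
lemma reaches_inv (hconn : G.Connected) {x₀ : V} (hx₀ : 3 ≤ G.deg x₀) (e : E) :
    G.Reaches (4 * R + 3 * N + 4) e (G.inv e) := by
  classical
  rcases reaches_inv_or_mem_cycle hdeg hcyc e with h | ⟨n, hn, c, hc, k, hk⟩
  · exact h.mono (by omega)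
  obtain ⟨j, hj⟩ : ∃ j, 3 ≤ G.deg (G.init (c j)) := by
    by_contra! hlt
    have h2 : ∀ k, G.deg (G.init (c k)) ≤ 2 := fun k => Nat.le_of_lt_succ (hlt k)
    obtain ⟨i, rfl⟩ := hc.exists_eq_init hconn h2 x₀
    exact absurd (h2 i) (by omega)
  obtain ⟨i, hi⟩ := hc.exists_pred j
  obtain ⟨f, hf, hfn⟩ : ∃ f ∈ G.star (G.init (c j)), f ∉ ({c j, G.inv (c i)} : Finset E) :=
    Finset.exists_mem_notMem_of_card_lt_card (Finset.card_le_two.trans_lt hj)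
  simp only [Finset.mem_insert, Finset.mem_singleton, not_or] at hfn
  rw [mem_star] at hf
  have hfc : ∀ l, f ≠ c l ∧ f ≠ G.inv (c l) := by
    refine fun l => ⟨fun h => hfn.1 ?_, fun h => hfn.2 ?_⟩
    · rw [h]
      exact hc.inj _ _ (by rw [← h, hf])
    · have h1 : c (l + 1) = c (i + 1) := by
        rw [hi]
        exact hc.inj _ _ (by rw [hc.init_succ, ← hf, h, init_inv])
      -- the predecessors agree too, because the cycle has only one edge with a given end
      have h3 : c l = c i := by
        have aux : ∀ a b, c (a + 1) = c (b + 1) → c a = c b := by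
          intro a b hab
          have hp : Function.Periodic c n := hc.periodic
          have step : ∀ m, c (a + 1 + m) = c (b + 1 + m) := fun m => by
            induction m with
            | zero => exact hab
            | succ m ih =>
              refine hc.inj _ _ ?_
              rw [← add_assoc, ← add_assoc, hc.init_succ, hc.init_succ, ih]
          have hn0 := hc.pos
          have h := step (n - 1)
          rwa [show a + 1 + (n - 1) = a + n by omega, show b + 1 + (n - 1) = b + n by omega,
            hp, hp] at h
        exact aux l i h1
      rw [h, h3]
  obtain ⟨g, hg, hgf⟩ := exists_reaches_term_eq hdeg hcyc f
  obtain ⟨g', hg', ⟨l, hl⟩, hg'f⟩ := hg.exists_first_hit {v | ∃ k, v = G.init (c k)}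
    ⟨j, hgf.trans hf⟩
  have hgc : ∀ l, g' ≠ c l ∧ g' ≠ G.inv (c l) := by
    rcases hg'f with rfl | h
    · exact hfc
    · refine fun l => ⟨fun h1 => h ⟨l, by rw [h1]⟩, fun h1 => h ⟨l + 1, ?_⟩⟩
      rw [h1, init_inv, hc.init_succ]
  rcases hk with rfl | rfl
  · obtain ⟨l', hl'⟩ := hc.exists_pred l
    have h1 : G.Follows (c i) f := ⟨by rw [hf, ← hi, hc.init_succ], hfn.2⟩
    have h2 : G.Follows g' (G.inv (c l')) :=
      ⟨by rw [hl, init_inv, ← hl', hc.init_succ], fun h => (hgc l').1 (G.inv_injective h).symm⟩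
    exact ((((hc.reaches k i).trans h1.reaches).trans hg').trans
      (h2.reaches.trans (hc.reaches k l').rev)).mono (by omega)
  · have h1 : G.Follows (G.inv (c j)) f := ⟨by rw [hf, term_inv], by simpa using hfn.1⟩
    have h2 : G.Follows g' (c l) := ⟨hl.symm, fun h => (hgc l).2 (by simp [h])⟩
    rw [inv_inv']
    exact ((((hc.reaches j k).rev.trans h1.reaches).trans hg').trans
      (h2.reaches.trans (hc.reaches l k))).mono (by omega)

end TurnAround

/-- If small cycles are dense, the degrees are between `2` and `M`, and not all of them are `2`,
then non-backtracking walk can turn around within a bounded number of steps. -/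
lemma exists_reaches_inv {M : ℕ} (hM : ∀ x, 2 ≤ G.deg x ∧ G.deg x ≤ M) (hconn : G.Connected)
    (hcyc : G.SmallCyclesDense) {x₀ : V} (hx₀ : 3 ≤ G.deg x₀) :
    ∃ K, ∀ e, G.Reaches K e (G.inv e) := by
  classical
  obtain ⟨R, -, hR⟩ := hcyc
  refine ⟨_, reaches_inv (N := (M + 1) ^ R) (R := R) (fun x => (hM x).1) (fun x => ?_) hconn hx₀⟩
  obtain ⟨n, c, hc, hb⟩ := hR x
  refine ⟨n, ?_, _, hc.periodicCycle, fun k => hb _ (Nat.mod_lt k hc.1)⟩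
  have hsub : (Finset.range n).image (fun k => G.init (c k)) ⊆ G.nbhd R x := by
    intro v hv
    obtain ⟨k, hk, rfl⟩ := Finset.mem_image.1 hv
    obtain ⟨p, hp⟩ := exists_walk_of_mem_ball (hb k (Finset.mem_range.1 hk))
    exact nbhd_mono hp x (mem_nbhd_of_walk p)
  have h := (Finset.card_le_card hsub).trans (card_nbhd_le (fun x => (hM x).2) R x)
  rwa [Finset.card_image_of_injOn (by simpa using hc.2.2.1), Finset.card_range] at h

section Irreducible

variable {K : ℕ} (hT : ∀ e, G.Reaches K e (G.inv e))
include hT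

lemma reaches_of_init_eq_term {e f : E} (h : G.init f = G.term e) : G.Reaches (K + 1) e f := by
  by_cases hf : f = G.inv e
  · exact hf ▸ (hT e).mono (by omega)
  · exact (Follows.reaches ⟨h, hf⟩).mono (by omega)

lemma reaches_of_init_eq_init {e f : E} (h : G.init e = G.init f) : G.Reaches (2 * K + 1) e f :=
  ((hT e).trans (reaches_of_init_eq_term hT (by simp [h]))).mono (by omega)

/-- The edge chain is irreducible. -/
lemma exists_nbPath_of_connected (hconn : G.Connected) (e f : E) : ∃ n, G.NBPath n e f := by
  have key : ∀ {x y : V} (p : G.toSimple.Walk x y) (e f : E), G.term e = x → G.init f = y →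
      ∃ n, G.NBPath n e f := by
    intro x y p
    induction p with
    | nil =>
      intro e f he hf
      obtain ⟨n, -, h⟩ := reaches_of_init_eq_term hT (hf.trans he.symm)
      exact ⟨n, h⟩
    | cons hadj p ih =>
      intro e f he hf
      obtain ⟨-, b, hb, hb'⟩ := hadj
      obtain ⟨m, -, h⟩ := reaches_of_init_eq_term hT (hb.trans he.symm)
      obtain ⟨n, h'⟩ := ih b f hb' hf
      exact ⟨m + n, h.trans h'⟩
  obtain ⟨p⟩ := hconn.preconnected (G.term e) (G.init f)
  exact key p e f rfl rfl

end Irreducible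

/-! ### Exponential bounds -/

/-- `s n = O(rⁿ)`, with a constant that is valid from `n = 0` on. -/
def ExpBounded (r : ℝ) (s : ℕ → ℝ) : Prop := ∃ C : ℝ, ∀ n, s n ≤ C * r ^ n

section Rate

variable {s : ℕ → ℝ} (h0 : ∀ n, 0 ≤ s n) (h1 : ∀ n, s n ≤ 1)
include h0 h1

lemma root_le_one (n : ℕ) : s n ^ (1 / (n : ℝ)) ≤ 1 :=
  Real.rpow_le_one (h0 n) (h1 n) (by positivity)

omit h1 in
lemma root_nonneg (n : ℕ) : 0 ≤ s n ^ (1 / (n : ℝ)) := Real.rpow_nonneg (h0 n) _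

lemma isBoundedUnder_root : IsBoundedUnder (· ≤ ·) atTop fun n : ℕ => s n ^ (1 / (n : ℝ)) :=
  isBoundedUnder_of ⟨1, root_le_one h0 h1⟩

omit h1 in
lemma isCoboundedUnder_root : IsCoboundedUnder (· ≤ ·) atTop fun n : ℕ => s n ^ (1 / (n : ℝ)) :=
  IsBoundedUnder.isCoboundedUnder_le (isBoundedUnder_of ⟨0, root_nonneg h0⟩)

lemma limsup_root_le_one : limsup (fun n : ℕ => s n ^ (1 / (n : ℝ))) atTop ≤ 1 :=
  limsup_le_of_le (isCoboundedUnder_root h0) (.of_forall (root_le_one h0 h1))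

lemma limsup_root_nonneg : 0 ≤ limsup (fun n : ℕ => s n ^ (1 / (n : ℝ))) atTop :=
  le_limsup_of_le (isBoundedUnder_root h0 h1) fun _ hb =>
    (hb.exists.elim fun n hn => (root_nonneg h0 n).trans hn)

lemma expBounded_of_limsup_root_lt {r : ℝ} (hr : 0 < r) (hr1 : r ≤ 1)
    (h : limsup (fun n : ℕ => s n ^ (1 / (n : ℝ))) atTop < r) : ExpBounded r s := by
  obtain ⟨N, hN⟩ := eventually_atTop.1 (eventually_lt_of_limsup_lt h (isBoundedUnder_root h0 h1))
  have hrN : (1 : ℝ) ≤ (r ^ (N + 1))⁻¹ := (one_le_inv₀ (pow_pos hr _)).2 (pow_le_one₀ hr.le hr1)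
  refine ⟨(r ^ (N + 1))⁻¹, fun n => ?_⟩
  rcases Nat.lt_or_ge n (N + 1) with hn | hn
  · refine (h1 n).trans ?_
    rw [inv_mul_eq_div, one_le_div (pow_pos hr _)]
    exact pow_le_pow_of_le_one hr.le hr1 hn.le
  · have hlt := hN n (by omega)
    have hn0 : n ≠ 0 := by omega
    calc s n = (s n ^ (1 / (n : ℝ))) ^ n := by
          rw [one_div, Real.rpow_inv_natCast_pow (h0 n) hn0]
      _ ≤ r ^ n := pow_le_pow_left₀ (root_nonneg h0 n) hlt.le n
      _ ≤ _ := le_mul_of_one_le_left (pow_nonneg hr.le n) hrN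

omit h1 in
lemma limsup_root_le_of_expBounded {r : ℝ} (hr : 0 < r) (h : ExpBounded r s) :
    limsup (fun n : ℕ => s n ^ (1 / (n : ℝ))) atTop ≤ r := by
  obtain ⟨C, hC⟩ := h
  set D := max C 1 with hD
  have hD0 : 0 < D := lt_of_lt_of_le one_pos (le_max_right _ _)
  have ht : Tendsto (fun n : ℕ => D ^ (1 / (n : ℝ)) * r) atTop (nhds r) := by
    have h2 : Tendsto (fun n : ℕ => D ^ (1 / (n : ℝ))) atTop (nhds (D ^ (0 : ℝ))) :=
      (Real.continuousAt_const_rpow hD0.ne').tendsto.comp tendsto_one_div_atTop_nhds_zero_nat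
    simpa using h2.mul_const r
  rw [← ht.limsup_eq]
  refine limsup_le_limsup ?_ (isCoboundedUnder_root h0) ht.isBoundedUnder_le
  filter_upwards [eventually_ne_atTop 0] with n hn
  calc s n ^ (1 / (n : ℝ)) ≤ (D * r ^ n) ^ (1 / (n : ℝ)) :=
        Real.rpow_le_rpow (h0 n) ((hC n).trans
          (mul_le_mul_of_nonneg_right (le_max_left _ _) (pow_nonneg hr.le n))) (by positivity)
    _ = _ := by
      rw [Real.mul_rpow hD0.le (pow_nonneg hr.le n), one_div, Real.pow_rpow_inv_natCast hr.le hn]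

end Rate

section Transfer

variable (hdeg : ∀ x : V, 2 ≤ G.deg x)
include hdeg

lemma exists_init_eq (x : V) : ∃ e, G.init e = x := by
  obtain ⟨e, he⟩ := Finset.card_pos.1 (lt_of_lt_of_le two_pos (hdeg x))
  exact ⟨e, by simpa using he⟩

/-- By irreducibility, an exponential bound for one pair of vertices yields one for all pairs of
oriented edges. -/
lemma expBounded_edgeProb (hirr : ∀ e f, ∃ n, G.NBPath n e f) {r : ℝ} {x y : V}
    (h : ExpBounded r fun n => G.nbProb n x y) (e f : E) :
    ExpBounded r fun n => G.edgeProb n e f := by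
  obtain ⟨C, hC⟩ := h
  obtain ⟨a, ha⟩ := exists_init_eq hdeg x
  obtain ⟨b, hb⟩ := exists_init_eq hdeg y
  obtain ⟨k, hk⟩ := hirr a e
  obtain ⟨l, hl⟩ := hirr f (G.inv b)
  have hk0 := edgeProb_pos hdeg hk
  have hl0 := edgeProb_pos hdeg hl
  refine ⟨G.deg x * C * r ^ (k + l + 1) / (G.edgeProb k a e * G.edgeProb l f (G.inv b)),
    fun n => ?_⟩
  rw [div_mul_eq_mul_div, le_div_iff₀ (mul_pos hk0 hl0)]
  calc G.edgeProb n e f * (G.edgeProb k a e * G.edgeProb l f (G.inv b))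
      = G.edgeProb k a e * G.edgeProb n e f * G.edgeProb l f (G.inv b) := by ring
    _ ≤ G.edgeProb (k + n) a f * G.edgeProb l f (G.inv b) :=
        mul_le_mul_of_nonneg_right (edgeProb_mul_le hdeg k n a e f) hl0.le
    _ ≤ G.edgeProb (k + n + l) a (G.inv b) := edgeProb_mul_le hdeg _ l a f _
    _ ≤ G.deg x * G.nbProb (k + n + l + 1) x y := edgeProb_le_nbProb hdeg _ ha hb
    _ ≤ G.deg x * (C * r ^ (k + n + l + 1)) := mul_le_mul_of_nonneg_left (hC _) (by positivity)
    _ = _ := by ring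

lemma expBounded_nbProb {r : ℝ} (hr : 0 < r)
    (h : ∀ e f, ExpBounded r fun n => G.edgeProb n e f) (x y : V) :
    ExpBounded r fun n => G.nbProb n x y := by
  choose C hC using h
  have hC0 : ∀ e f, 0 ≤ C e f := fun e f => by
    simpa using (edgeProb_nonneg hdeg 0 e f).trans (hC e f 0)
  set S := ∑ e ∈ G.star x, ∑ f ∈ G.star y, C e (G.inv f) with hS
  have hS0 : 0 ≤ S := Finset.sum_nonneg fun e _ => Finset.sum_nonneg fun f _ => hC0 _ _
  have h2 : (2 : ℝ) ≤ G.deg x := by exact_mod_cast hdeg x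
  refine ⟨1 + S / r, fun n => ?_⟩
  cases n with
  | zero =>
    simp only [pow_zero, mul_one]
    exact (nbProb_le_one hdeg 0 x y).trans (le_add_of_nonneg_right (by positivity))
  | succ n =>
    have h3 : ∑ e ∈ G.star x, ∑ f ∈ G.star y, G.edgeProb n e (G.inv f) ≤ S * r ^ n := by
      rw [hS, Finset.sum_mul]
      refine Finset.sum_le_sum fun e _ => ?_
      rw [Finset.sum_mul]
      exact Finset.sum_le_sum fun f _ => hC _ _ _
    calc G.nbProb (n + 1) x y ≤ 1 * ∑ e ∈ G.star x, ∑ f ∈ G.star y, G.edgeProb n e (G.inv f) := by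
          rw [nbProb]
          refine mul_le_mul_of_nonneg_right ?_ (Finset.sum_nonneg fun e _ =>
            Finset.sum_nonneg fun f _ => edgeProb_nonneg hdeg n e _)
          rw [div_le_one (by linarith)]
          linarith
      _ ≤ S * r ^ n := by rwa [one_mul]
      _ = S / r * r ^ (n + 1) := by rw [pow_succ]; field_simp
      _ ≤ (1 + S / r) * r ^ (n + 1) :=
          mul_le_mul_of_nonneg_right (by linarith) (by positivity)

lemma nbRate_le_one (x y : V) : G.nbRate x y ≤ 1 :=
  limsup_root_le_one (fun n => nbProb_nonneg hdeg n x y) fun n => nbProb_le_one hdeg n x y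

lemma nbRate_nonneg (x y : V) : 0 ≤ G.nbRate x y :=
  limsup_root_nonneg (fun n => nbProb_nonneg hdeg n x y) fun n => nbProb_le_one hdeg n x y

lemma expBounded_of_nbRate_lt {x y : V} {r : ℝ} (hr : r ≤ 1) (h : G.nbRate x y < r) :
    ExpBounded r fun n => G.nbProb n x y :=
  expBounded_of_limsup_root_lt (fun n => nbProb_nonneg hdeg n x y)
    (fun n => nbProb_le_one hdeg n x y) ((nbRate_nonneg hdeg x y).trans_lt h) hr h

lemma nbRate_le_of_expBounded {x y : V} {r : ℝ} (hr : 0 < r)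
    (h : ExpBounded r fun n => G.nbProb n x y) : G.nbRate x y ≤ r :=
  limsup_root_le_of_expBounded (fun n => nbProb_nonneg hdeg n x y) hr h

lemma nbRate_le_nbRate (hirr : ∀ e f, ∃ n, G.NBPath n e f) (x y x' y' : V) :
    G.nbRate x' y' ≤ G.nbRate x y := by
  by_contra! h
  obtain ⟨r, hr, hr'⟩ := exists_between h
  have hr0 := (nbRate_nonneg hdeg x y).trans_lt hr
  have hr1 := hr'.le.trans (nbRate_le_one hdeg x' y')
  exact absurd (nbRate_le_of_expBounded hdeg hr0 (expBounded_nbProb hdeg hr0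
    (expBounded_edgeProb hdeg hirr (expBounded_of_nbRate_lt hdeg hr1 hr)) x' y')) hr'.not_ge

lemma nbRate_pos (hirr : ∀ e f, ∃ n, G.NBPath n e f) (x y : V) : 0 < G.nbRate x y := by
  by_contra! h
  obtain ⟨e, -⟩ := exists_init_eq hdeg x
  obtain ⟨f, hf⟩ := exists_follows hdeg e
  obtain ⟨l, hl⟩ := hirr f e
  have hp : G.NBPath (l + 1) e e := .cons hf hl
  have hq := edgeProb_pos hdeg hp
  set q := G.edgeProb (l + 1) e e with hqdef
  have hq1 : q ≤ 1 := by simpa using sum_edgeProb_le_one hdeg (l + 1) {e} e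
  -- with `r = q / 2`, running `m` times through this closed path has probability at least `q ^ m`,
  -- which contradicts the bound by `C * r ^ ((l + 1) * m) ≤ C * r ^ m`
  have hr0 : 0 < q / 2 := by positivity
  obtain ⟨C, hC⟩ := expBounded_edgeProb hdeg hirr
    (expBounded_of_nbRate_lt hdeg (by linarith) (h.trans_lt hr0)) e e
  have hpow : ∀ m : ℕ, q ^ m ≤ G.edgeProb ((l + 1) * m) e e := fun m => by
    induction m with
    | zero => simp [edgeProb]
    | succ m ih =>
      rw [pow_succ, mul_add, mul_one]
      exact (mul_le_mul_of_nonneg_right ih hq.le).trans (edgeProb_mul_le hdeg _ _ e e e)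
  have hbound : ∀ m : ℕ, (2 : ℝ) ^ m ≤ C := fun m => by
    have h1 : q ^ m ≤ C * (q / 2) ^ m := by
      refine (hpow m).trans ((hC _).trans (mul_le_mul_of_nonneg_left ?_ ?_))
      · exact pow_le_pow_of_le_one hr0.le (by linarith) (Nat.le_mul_of_pos_left m (by omega))
      · simpa using (edgeProb_nonneg hdeg 0 e e).trans (hC 0)
    rw [div_pow, mul_div_assoc', le_div_iff₀ (by positivity), mul_comm] at h1
    exact le_of_mul_le_mul_right h1 (pow_pos hq m)
  obtain ⟨m, hm⟩ := pow_unbounded_of_one_lt C one_lt_two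
  exact (hbound m).not_gt hm

end Transfer

/-! ### Exponential decay excludes amenability -/

lemma isoperimetricConstant_le {F : Finset V} (hF : F.Nonempty) :
    G.isoperimetricConstant ≤ (G.area F : ℝ) / G.vol F :=
  ciInf_le (f := fun F : {F : Finset V // F.Nonempty} => (G.area F.1 : ℝ) / (G.vol F.1 : ℝ))
    ⟨0, by rintro _ ⟨F, rfl⟩; positivity⟩ ⟨F, hF⟩

lemma isoperimetricConstant_nonneg : 0 ≤ G.isoperimetricConstant :=
  Real.iInf_nonneg fun F => by positivity

open Classical in
variable (G) in
/-- The oriented edges that start in `F`. -/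
noncomputable def outEdges (F : Finset V) : Finset E := F.biUnion G.star

@[simp] lemma mem_outEdges {F : Finset V} {e : E} : e ∈ G.outEdges F ↔ G.init e ∈ F := by
  simp [outEdges]

open Classical in
lemma sum_outEdges (F : Finset V) (u : E → ℝ) :
    ∑ e ∈ G.outEdges F, u e = ∑ x ∈ F, ∑ e ∈ G.star x, u e :=
  Finset.sum_biUnion fun _ _ _ _ hxy => Finset.disjoint_left.2 fun _ he he' =>
    hxy (((mem_star G).1 he).symm.trans ((mem_star G).1 he'))

lemma card_outEdges (F : Finset V) : (G.outEdges F).card = G.vol F := by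
  have h := sum_outEdges (G := G) F fun _ => 1
  simp only [Finset.sum_const, nsmul_eq_mul, mul_one] at h
  have h' : ((G.outEdges F).card : ℝ) = (G.vol F : ℕ) := by
    rw [h, vol, Nat.cast_sum]; rfl
  exact_mod_cast h'

open Classical in
lemma area_eq_card (F : Finset V) :
    G.area F = ((G.outEdges F).filter fun e => G.term e ∉ F).card := by
  rw [area, ← Set.ncard_coe_finset]
  congr 1
  ext e
  simp

section NotAmenable

variable (hdeg : ∀ x : V, 2 ≤ G.deg x)
include hdeg

/-- Each step carries at most `Area(F)` of the mass of the edge chain, started with mass `1` on every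
edge that starts in `F`, out of this set of edges; so does the final reversal of the edge. -/
lemma vol_sub_le_sum_edgeProb (F : Finset V) (n : ℕ) :
    (G.vol F : ℝ) - (n + 1) * G.area F ≤
      ∑ e ∈ G.outEdges F, ∑ f ∈ G.outEdges F, G.edgeProb n e (G.inv f) := by
  classical
  set H := G.outEdges F with hH
  have hinv : ∀ n, ∑ e ∈ H, ∑ f ∈ H, G.edgeProb n e f - G.area F ≤
      ∑ e ∈ H, ∑ f ∈ H, G.edgeProb n e (G.inv f) := by
    intro n
    have h1 : ∀ e, ∑ f ∈ H, G.edgeProb n e f ≤ ∑ f ∈ H, G.edgeProb n e (G.inv f) +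
        ∑ f ∈ H.filter (fun f => G.term f ∉ F), G.edgeProb n e f := by
      intro e
      rw [← Finset.sum_filter_add_sum_filter_not H (fun f => G.term f ∉ F), add_comm]
      gcongr
      rw [← Finset.sum_image (s := H) (f := fun f => G.edgeProb n e f)
        fun a _ b _ h => G.inv_injective h]
      refine Finset.sum_le_sum_of_subset_of_nonneg (fun f hf => ?_)
        fun f _ _ => edgeProb_nonneg hdeg n e f
      simp only [not_not, Finset.mem_filter] at hf
      exact Finset.mem_image.2 ⟨G.inv f, by simpa [hH] using hf.2, by simp⟩
    have h2 := Finset.sum_le_sum fun e (_ : e ∈ H) => h1 e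
    rw [Finset.sum_add_distrib] at h2
    have h3 : ∑ e ∈ H, ∑ f ∈ H.filter (fun f => G.term f ∉ F), G.edgeProb n e f ≤ G.area F := by
      rw [Finset.sum_comm, area_eq_card]
      exact (Finset.sum_le_card_nsmul _ _ 1 fun f _ => sum_edgeProb_col_le_one hdeg n H f).trans
        (by simp [hH])
    linarith
  -- an edge that ends in `F` is followed by edges that start in `F`
  have hsucc : ∀ n e, ∑ f ∈ H, G.edgeProb (n + 1) e f = ∑ f ∈ H, G.edgeProb n e (G.inv f) := by
    intro n e
    rw [hH, sum_outEdges, sum_outEdges]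
    refine Finset.sum_congr rfl fun x _ => ?_
    have h1 : ∀ f ∈ G.star x, G.edgeProb (n + 1) e f =
        ∑ k ∈ G.star x, G.edgeProb n e (G.inv k) * G.edgeStep (G.inv k) f := fun f hf => by
      rw [edgeProb_succ_right, (mem_star G).1 hf]
    rw [Finset.sum_congr rfl h1, Finset.sum_comm]
    refine Finset.sum_congr rfl fun k hk => ?_
    have h2 := act_one hdeg (G.inv k)
    rw [term_inv, (mem_star G).1 hk] at h2
    rw [← Finset.mul_sum, h2, mul_one]
  have hM : ∀ n : ℕ, (G.vol F : ℝ) - n * G.area F ≤ ∑ e ∈ H, ∑ f ∈ H, G.edgeProb n e f := by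
    intro n
    induction n with
    | zero =>
      simp only [edgeProb, Finset.sum_ite_eq, Nat.cast_zero, zero_mul, sub_zero]
      rw [Finset.sum_congr rfl fun e he => if_pos he, ← card_outEdges, ← hH]
      simp
    | succ n ih =>
      rw [Finset.sum_congr rfl fun e _ => hsucc n e]
      refine le_trans ?_ (hinv n)
      push_cast
      linarith
  refine le_trans ?_ (hinv n)
  have := hM n
  linarith

/-- An exponential bound with `r < 1` for the edge chain gives a positive function with
`Q h ≤ r' h` and `r' < 1`, namely a Green function at a point beyond `1`. -/
lemma exists_act_le (hirr : ∀ e f, ∃ n, G.NBPath n e f) {r : ℝ} (hr : 0 < r) (hr1 : r < 1)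
    (h : ∀ e f, ExpBounded r fun n => G.edgeProb n e f) (f : E) :
    ∃ (u : E → ℝ) (r' : ℝ), 0 < r' ∧ r' < 1 ∧ (∀ e, 0 < u e) ∧ ∀ e, G.act u e ≤ r' * u e := by
  obtain ⟨r', hrr', hr'1⟩ := exists_between hr1
  have hr' : 0 < r' := hr.trans hrr'
  have hterm : ∀ e n, 0 ≤ r'⁻¹ ^ n * G.edgeProb n e f := fun e n =>
    mul_nonneg (by positivity) (edgeProb_nonneg hdeg n e f)
  have hsum : ∀ e, Summable fun n => r'⁻¹ ^ n * G.edgeProb n e f := by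
    intro e
    obtain ⟨C, hC⟩ := h e f
    have hg : Summable fun n : ℕ => C * (r / r') ^ n :=
      (summable_geometric_of_lt_one (by positivity) ((div_lt_one hr').2 hrr')).mul_left C
    refine Summable.of_nonneg_of_le (hterm e) (fun n => ?_) hg
    calc r'⁻¹ ^ n * G.edgeProb n e f ≤ r'⁻¹ ^ n * (C * r ^ n) :=
          mul_le_mul_of_nonneg_left (hC n) (by positivity)
      _ = C * (r / r') ^ n := by rw [div_pow, inv_pow]; field_simp
  refine ⟨fun e => ∑' n, r'⁻¹ ^ n * G.edgeProb n e f, r', hr', hr'1, fun e => ?_, fun e => ?_⟩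
  · obtain ⟨n, hn⟩ := hirr e f
    exact (hsum e).tsum_pos (hterm e) n (mul_pos (by positivity) (edgeProb_pos hdeg hn))
  · have h1 : G.act (fun e => ∑' n, r'⁻¹ ^ n * G.edgeProb n e f) e =
        ∑' n, r'⁻¹ ^ n * G.edgeProb (n + 1) e f := by
      simp only [act, edgeProb, Finset.mul_sum, ← tsum_mul_left]
      rw [Summable.tsum_finsetSum fun g _ => ?_]
      · exact Finset.sum_congr rfl fun g _ => tsum_congr fun n => by ring
      · refine ((hsum g).mul_left (G.edgeStep e g)).congr fun n => by ring
    rw [h1]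
    beta_reduce
    rw [(hsum e).tsum_eq_zero_add, mul_add, ← tsum_mul_left]
    refine le_add_of_nonneg_of_le (mul_nonneg hr'.le (hterm e 0)) (le_of_eq (tsum_congr fun n => ?_))
    rw [pow_succ', mul_assoc, mul_inv_cancel_left₀ hr'.ne']

omit hdeg in
/-- If walks can turn around within boundedly many steps, then the symmetric matrices with entries
`q_E^{(n)}(e, f̌)` inherit the decay of the edge chain. By the Schur test this bounds their mean
over a finite set, which is close to `1` on sets with small boundary. -/
lemma not_amenable_of_expBounded {M K : ℕ} (hM : ∀ x, 2 ≤ G.deg x ∧ G.deg x ≤ M)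
    (hT : ∀ e, G.Reaches K e (G.inv e))
    (hirr : ∀ e f, ∃ n, G.NBPath n e f) {r : ℝ} (hr : 0 < r) (hr1 : r < 1) [Nonempty V]
    (h : ∀ e f, ExpBounded r fun n => G.edgeProb n e f) : ¬ G.Amenable := by
  have hdeg := fun x => (hM x).1
  obtain ⟨x₀⟩ := ‹Nonempty V›
  obtain ⟨e₀, -⟩ := exists_init_eq hdeg x₀
  have hM0 : (0 : ℝ) < M := by
    exact_mod_cast (lt_of_lt_of_le two_pos ((hM x₀).1.trans (hM x₀).2))
  have hM1 : 1 / (M : ℝ) ≤ 1 := by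
    rw [div_le_one hM0]
    exact_mod_cast (show 1 ≤ M by exact_mod_cast hM0)
  obtain ⟨u, t, ht, ht1, hu, hact⟩ := exists_act_le hdeg hirr hr hr1 h e₀
  have hQ := sum_edgeProb_mul_le hdeg ht.le (fun e => (hu e).le) hact
  set ε : ℝ := (1 / (M : ℝ)) ^ K with hε
  have hε0 : 0 < ε := by positivity
  have huinv : ∀ e, ε * u e ≤ u (G.inv e) := by
    intro e
    obtain ⟨k, hk, hp⟩ := hT (G.inv e)
    rw [inv_inv'] at hp
    have h1 := hQ k {e} (G.inv e)
    rw [Finset.sum_singleton] at h1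
    calc ε * u e ≤ G.edgeProb k (G.inv e) e * u e :=
          mul_le_mul_of_nonneg_right ((pow_le_pow_of_le_one (by positivity) hM1 hk).trans
            (pow_le_edgeProb hM hp)) (hu e).le
      _ ≤ t ^ k * u (G.inv e) := h1
      _ ≤ u (G.inv e) := mul_le_of_le_one_left (hu _).le (pow_le_one₀ ht.le ht1.le)
  obtain ⟨n, hn⟩ := exists_pow_lt_of_lt_one (show 0 < ε / 2 by positivity) ht1
  have hrow : ∀ (H : Finset E) e, ∑ f ∈ H, G.edgeProb n e (G.inv f) * u f ≤ 1 / 2 * u e := by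
    classical
    intro H e
    have h1 : ε * ∑ f ∈ H, G.edgeProb n e (G.inv f) * u f ≤ t ^ n * u e := by
      refine le_trans ?_ (hQ n (H.image G.inv) e)
      rw [Finset.sum_image fun a _ b _ h => G.inv_injective h, Finset.mul_sum]
      refine Finset.sum_le_sum fun f _ => ?_
      rw [mul_left_comm]
      exact mul_le_mul_of_nonneg_left (huinv f) (edgeProb_nonneg hdeg n e _)
    have h2 : t ^ n * u e ≤ ε * (1 / 2 * u e) := by
      rw [← mul_assoc]
      exact mul_le_mul_of_nonneg_right (by linarith) (hu e).le
    exact le_of_mul_le_mul_left (h1.trans h2) hε0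
  have hschur : ∀ H : Finset E,
      ∑ e ∈ H, ∑ f ∈ H, G.edgeProb n e (G.inv f) ≤ 1 / 2 * H.card := by
    intro H
    have hAM : ∀ e f, G.edgeProb n e (G.inv f) ≤ 1 / 2 *
        (G.edgeProb n e (G.inv f) * u f / u e + G.edgeProb n f (G.inv e) * u e / u f) := by
      intro e f
      rw [← edgeProb_rev n e f, mul_div_assoc, mul_div_assoc, ← mul_add]
      have h1 : 2 ≤ u f / u e + u e / u f := by
        have h3 := hu e
        have h4 := hu f
        rw [div_add_div _ _ h3.ne' h4.ne', le_div_iff₀ (mul_pos h3 h4)]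
        nlinarith [sq_nonneg (u e - u f)]
      nlinarith [mul_le_mul_of_nonneg_left h1 (edgeProb_nonneg hdeg n e (G.inv f))]
    have hone : ∑ e ∈ H, ∑ f ∈ H, G.edgeProb n e (G.inv f) * u f / u e ≤ 1 / 2 * H.card := by
      refine (Finset.sum_le_card_nsmul _ _ (1 / 2) fun e _ => ?_).trans
        (by rw [nsmul_eq_mul, mul_comm])
      rw [← Finset.sum_div, div_le_iff₀ (hu e)]
      exact hrow H e
    calc ∑ e ∈ H, ∑ f ∈ H, G.edgeProb n e (G.inv f)
        ≤ ∑ e ∈ H, ∑ f ∈ H, 1 / 2 *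
          (G.edgeProb n e (G.inv f) * u f / u e + G.edgeProb n f (G.inv e) * u e / u f) :=
          Finset.sum_le_sum fun e _ => Finset.sum_le_sum fun f _ => hAM e f
      _ = 1 / 2 * (∑ e ∈ H, ∑ f ∈ H, G.edgeProb n e (G.inv f) * u f / u e +
            ∑ f ∈ H, ∑ e ∈ H, G.edgeProb n f (G.inv e) * u e / u f) := by
          simp only [← Finset.mul_sum, Finset.sum_add_distrib]
          rw [Finset.sum_comm (f := fun e f => G.edgeProb n f (G.inv e) * u e / u f)]
      _ ≤ 1 / 2 * H.card := by linarith
  have hiso : ∀ F : {F : Finset V // F.Nonempty},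
      1 / (2 * ((n : ℝ) + 1)) ≤ (G.area F.1 : ℝ) / G.vol F.1 := by
    rintro ⟨F, x, hx⟩
    have h1 := (vol_sub_le_sum_edgeProb hdeg F n).trans (hschur _)
    rw [card_outEdges] at h1
    have hvol : (0 : ℝ) < G.vol F := by
      have h2 : G.deg x ≤ G.vol F := Finset.single_le_sum (f := G.deg) (fun _ _ => Nat.zero_le _) hx
      have h3 := hdeg x
      exact_mod_cast (show 0 < G.vol F by omega)
    rw [div_le_div_iff₀ (by positivity) hvol]
    linarith
  intro ham
  have : Nonempty {F : Finset V // F.Nonempty} := ⟨⟨{x₀}, by simp⟩⟩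
  have h1 : 1 / (2 * ((n : ℝ) + 1)) ≤ G.isoperimetricConstant := le_ciInf hiso
  rw [show G.isoperimetricConstant = 0 from ham] at h1
  exact absurd h1 (not_le.2 (by positivity))

end NotAmenable

/-! ### Isoperimetry for the edge chain -/

lemma NBPath.exists_exit {n : ℕ} {a g : E} (h : G.NBPath n a g) {A : Set E} (ha : a ∈ A)
    (hg : g ∉ A) : ∃ m ≤ n, ∃ p q, G.NBPath m a p ∧ p ∈ A ∧ q ∉ A ∧ G.Follows p q := by
  induction h with
  | refl e => exact absurd ha hg
  | @cons n a b g hs _ ih =>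
    by_cases hb : b ∈ A
    · obtain ⟨m, hm, p, q, hp, h⟩ := ih hb hg
      exact ⟨m + 1, by omega, p, q, .cons hs hp, h⟩
    · exact ⟨0, Nat.zero_le _, a, b, .refl a, ha, hb, hs⟩

open Classical in
/-- On a non-amenable graph, many steps of the edge chain leave a finite set `A` of oriented edges:
every edge in the boundary of the set of initial vertices of `A` is at bounded distance from such
a step, because one can turn around near it. -/
lemma exists_edge_isoperimetry {M K : ℕ} (hM : ∀ x, 2 ≤ G.deg x ∧ G.deg x ≤ M)
    (hT : ∀ e, G.Reaches K e (G.inv e)) (hG : 0 < G.isoperimetricConstant) :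
    ∃ η : ℝ, 0 < η ∧ ∀ (A : Finset E) (P : Finset (Σ _ : E, E)),
      (∀ p q, p ∈ A → q ∉ A → G.Follows p q → ⟨p, q⟩ ∈ P) →
      η * A.card ≤ (P.filter fun p => p.1 ∈ A ∧ p.2 ∉ A).card := by
  set N : ℕ := (M + 1) ^ (2 * K + 2) * (M + 1) with hN
  have hN0 : (0 : ℝ) < N := by
    rw [hN]; positivity
  refine ⟨G.isoperimetricConstant / N, by positivity, fun A P hP => ?_⟩
  rcases A.eq_empty_or_nonempty with rfl | hA
  · simp
  set F := A.image G.init with hF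
  have hvol : A.card ≤ G.vol F := by
    rw [← card_outEdges]
    exact Finset.card_le_card fun e he => mem_outEdges.2 (Finset.mem_image_of_mem _ he)
  have hvol0 : (0 : ℝ) < G.vol F := by
    exact_mod_cast lt_of_lt_of_le (Finset.card_pos.2 hA) hvol
  have hiso : G.isoperimetricConstant * G.vol F ≤ G.area F := by
    rw [← le_div_iff₀ hvol0]
    exact isoperimetricConstant_le (hA.image _)
  have hcover : ((G.outEdges F).filter fun e => G.term e ∉ F) ⊆
      (P.filter fun p => p.1 ∈ A ∧ p.2 ∉ A).biUnion
        fun p => G.outEdges (G.nbhd (2 * K + 2) (G.init p.1)) := by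
    intro e he
    simp only [Finset.mem_filter, mem_outEdges] at he
    obtain ⟨a, ha, hae⟩ := Finset.mem_image.1 he.1
    obtain ⟨g, hg⟩ := exists_follows (fun x => (hM x).1) e
    have hgA : g ∉ A := fun h => he.2 (hg.1 ▸ Finset.mem_image_of_mem _ h)
    obtain ⟨n, hn, hp⟩ := (reaches_of_init_eq_init hT hae).trans hg.reaches
    obtain ⟨m, hm, p, q, hap, hpA, hqA, hpq⟩ := hp.exists_exit (A := (A : Set E)) ha hgA
    refine Finset.mem_biUnion.2 ⟨⟨p, q⟩, Finset.mem_filter.2 ⟨hP p q hpA hqA hpq, hpA, hqA⟩, ?_⟩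
    rw [mem_outEdges, ← hae]
    exact nbhd_mono (by omega) _ hap.init_mem_nbhd
  have hcard : G.area F ≤ (P.filter fun p => p.1 ∈ A ∧ p.2 ∉ A).card * N := by
    rw [area_eq_card]
    refine (Finset.card_le_card hcover).trans (Finset.card_biUnion_le_card_mul _ _ _ fun p _ => ?_)
    rw [card_outEdges]
    calc G.vol (G.nbhd (2 * K + 2) (G.init p.1))
        ≤ (G.nbhd (2 * K + 2) (G.init p.1)).card * M := by
          rw [vol, ← smul_eq_mul]
          exact Finset.sum_le_card_nsmul _ _ _ fun x _ => (hM x).2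
      _ ≤ N := Nat.mul_le_mul (card_nbhd_le (fun x => (hM x).2) _ _) (Nat.le_succ M)
  have hcard' : (G.area F : ℝ) ≤ (P.filter fun p => p.1 ∈ A ∧ p.2 ∉ A).card * N := by
    exact_mod_cast hcard
  have hvol' : (A.card : ℝ) ≤ G.vol F := by exact_mod_cast hvol
  rw [div_mul_eq_mul_div, div_le_iff₀ hN0]
  exact ((mul_le_mul_of_nonneg_left hvol' hG.le).trans hiso).trans hcard'

open Classical in
/-- The co-area inequality: an isoperimetric inequality for sets extends to nonnegative functions
with finite support. One removes the smallest value from the support and proceeds by induction. -/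
lemma sum_le_of_isoperimetry {α : Type*} {η : ℝ} (P : Finset (Σ _ : α, α)) (H : Finset α)
    (w : α → ℝ)
    (hP : ∀ A ⊆ H, η * A.card ≤ (P.filter fun p => p.1 ∈ A ∧ p.2 ∉ A).card)
    (hw : ∀ e, 0 ≤ w e) (hH : ∀ e, e ∉ H → w e = 0) :
    η * ∑ e ∈ H, w e ≤ ∑ p ∈ P, max (w p.1 - w p.2) 0 := by
  induction H using Finset.strongInduction generalizing w with
  | H H ih =>
    rcases H.eq_empty_or_nonempty with rfl | hne
    · simpa using Finset.sum_nonneg fun p (_ : p ∈ P) => le_max_right (w p.1 - w p.2) 0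
    obtain ⟨e₀, he₀, hmin⟩ := H.exists_min_image w hne
    set w' : α → ℝ := fun e => if e ∈ H then w e - w e₀ else 0 with hw'
    have hin : ∀ e ∈ H, w' e = w e - w e₀ := fun e he => if_pos he
    have hout : ∀ e ∉ H, w' e = 0 := fun e he => if_neg he
    have hw'0 : ∀ e, 0 ≤ w' e := fun e => by
      by_cases he : e ∈ H
      · rw [hin e he]; exact sub_nonneg.2 (hmin e he)
      · rw [hout e he]
    have h0 : w' e₀ = 0 := by rw [hin _ he₀, sub_self]
    have h1 := ih (H.erase e₀) (Finset.erase_ssubset he₀) w'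
      (fun A hA => hP A (hA.trans (Finset.erase_subset _ _))) hw'0 fun e he => by
        by_cases heH : e ∈ H
        · rw [show e = e₀ by by_contra h; exact he (Finset.mem_erase.2 ⟨h, heH⟩), h0]
        · exact hout e heH
    have hsum : ∑ e ∈ H, w e = ∑ e ∈ H.erase e₀, w' e + H.card * w e₀ := by
      rw [Finset.sum_erase _ h0, Finset.sum_congr rfl hin, Finset.sum_sub_distrib]
      simp
    have hterm : ∀ p ∈ P, max (w' p.1 - w' p.2) 0 +
        (if p.1 ∈ H ∧ p.2 ∉ H then w e₀ else 0) ≤ max (w p.1 - w p.2) 0 := by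
      intro p _
      by_cases h1 : p.1 ∈ H <;> by_cases h2 : p.2 ∈ H
      · simp [h1, h2, hin]
      · have := hmin _ h1
        simp [h1, h2, hin, hout, hH, hw, this]
      · have := hw'0 p.2
        simp [h1, hout, hH, hw, this]
      · simp [h1, h2, hout, hH]
    have h2 := Finset.sum_le_sum hterm
    rw [Finset.sum_add_distrib, ← Finset.sum_filter, Finset.sum_const, nsmul_eq_mul] at h2
    have h3 := mul_le_mul_of_nonneg_right (hP H subset_rfl) (hw e₀)
    rw [hsum]
    linarith

/-! ### The spectral gap -/

lemma edgeProb_one (e f : E) : G.edgeProb 1 e f = G.edgeStep e f := by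
  classical
  simp only [edgeProb, mul_ite, mul_one, mul_zero, Finset.sum_ite_eq', mem_star]
  split_ifs with h
  · rfl
  · exact (edgeStep_of_not fun h' => h h'.1).symm

lemma act_eq_sum {u : E → ℝ} {H : Finset E} (hu : ∀ e, e ∉ H → u e = 0) (e : E) :
    G.act u e = ∑ g ∈ H, G.edgeStep e g * u g := by
  classical
  have h1 : G.act u e = ∑ g ∈ G.star (G.term e) ∩ H, G.edgeStep e g * u g :=
    (Finset.sum_subset Finset.inter_subset_left fun g hg hg' => by
      rw [hu g fun h => hg' (Finset.mem_inter.2 ⟨hg, h⟩), mul_zero]).symm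
  rw [h1]
  refine Finset.sum_subset Finset.inter_subset_right fun g hg hg' => ?_
  rw [edgeStep_of_not, zero_mul]
  exact fun h => hg' (Finset.mem_inter.2 ⟨G.mem_star.2 h.1, hg⟩)

variable (G) in
/-- The averaging operator `(I + Q) / 2` of the lazy edge chain. -/
noncomputable def lazyAct (u : E → ℝ) (e : E) : ℝ := (u e + G.act u e) / 2

section Gap

variable (hdeg : ∀ x : V, 2 ≤ G.deg x)
include hdeg

lemma sum_act_le {u : E → ℝ} {H : Finset E} (h0 : ∀ e, 0 ≤ u e) (hu : ∀ e, e ∉ H → u e = 0)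
    (H' : Finset E) : ∑ e ∈ H', G.act u e ≤ ∑ e ∈ H, u e := by
  simp only [act_eq_sum hu]
  rw [Finset.sum_comm]
  refine Finset.sum_le_sum fun g _ => ?_
  rw [← Finset.sum_mul]
  refine mul_le_of_le_one_left (h0 g) ?_
  simpa only [edgeProb_one] using sum_edgeProb_col_le_one hdeg 1 H' g

lemma sq_act_le (u : E → ℝ) (e : E) : G.act u e ^ 2 ≤ G.act (fun g => u g ^ 2) e := by
  set m := G.act u e with hm
  have h1 : 0 ≤ ∑ g ∈ G.star (G.term e), G.edgeStep e g * (u g - m) ^ 2 :=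
    Finset.sum_nonneg fun g _ => mul_nonneg (edgeStep_nonneg hdeg e g) (sq_nonneg _)
  have h2 : ∑ g ∈ G.star (G.term e), G.edgeStep e g * (u g - m) ^ 2 =
      G.act (fun g => u g ^ 2) e - 2 * m * G.act u e +
        m ^ 2 * ∑ g ∈ G.star (G.term e), G.edgeStep e g := by
    simp only [act, Finset.mul_sum, ← Finset.sum_add_distrib, ← Finset.sum_sub_distrib]
    exact Finset.sum_congr rfl fun g _ => by ring
  rw [h2, act_one hdeg, ← hm] at h1
  linarith

lemma sum_sq_act_le {u : E → ℝ} {H : Finset E} (hu : ∀ e, e ∉ H → u e = 0)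
    (H' : Finset E) : ∑ e ∈ H', G.act u e ^ 2 ≤ ∑ e ∈ H, u e ^ 2 :=
  (Finset.sum_le_sum fun e _ => sq_act_le hdeg u e).trans
    (sum_act_le hdeg (fun e => sq_nonneg (u e)) (fun e he => by rw [hu e he]; norm_num) H')

/-- The edge chain is doubly stochastic, so the defect of `⟨u, Q u⟩` controls the Dirichlet form,
although the chain is not reversible. -/
lemma sum_edgeStep_mul_sq_sub_le {u : E → ℝ} {H : Finset E} (hu : ∀ e, e ∉ H → u e = 0) :
    ∑ e ∈ H, ∑ g ∈ G.star (G.term e), G.edgeStep e g * (u e - u g) ^ 2 ≤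
      2 * (∑ e ∈ H, u e ^ 2 - ∑ e ∈ H, u e * G.act u e) := by
  have h1 : ∀ e, ∑ g ∈ G.star (G.term e), G.edgeStep e g * (u e - u g) ^ 2 =
      u e ^ 2 * (∑ g ∈ G.star (G.term e), G.edgeStep e g) - 2 * (u e * G.act u e) +
        G.act (fun g => u g ^ 2) e := fun e => by
    simp only [act, Finset.mul_sum, ← Finset.sum_add_distrib, ← Finset.sum_sub_distrib]
    exact Finset.sum_congr rfl fun g _ => by ring
  simp only [h1, act_one hdeg, mul_one, Finset.sum_add_distrib, Finset.sum_sub_distrib,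
    ← Finset.mul_sum]
  have h2 := sum_act_le hdeg (fun e => sq_nonneg (u e))
    (fun e he => by rw [hu e he]; norm_num : ∀ e, e ∉ H → u e ^ 2 = 0) H
  linarith

omit hdeg in
/-- On a non-amenable graph, `⟨u, Q u⟩ ≤ (1 - δ) ‖u‖²` for nonnegative `u` with finite support. -/
lemma exists_spectral_gap {M K : ℕ} (hM : ∀ x, 2 ≤ G.deg x ∧ G.deg x ≤ M)
    (hT : ∀ e, G.Reaches K e (G.inv e)) (hG : 0 < G.isoperimetricConstant) :
    ∃ δ : ℝ, 0 < δ ∧ ∀ (u : E → ℝ) (H : Finset E), (∀ e, 0 ≤ u e) → (∀ e, e ∉ H → u e = 0) →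
      ∑ e ∈ H, u e * G.act u e ≤ (1 - δ) * ∑ e ∈ H, u e ^ 2 := by
  classical
  have hdeg := fun x => (hM x).1
  obtain ⟨η, hη, hiso⟩ := exists_edge_isoperimetry hM hT hG
  -- `max M 1` spares a case distinction for graphs without vertices
  set L : ℝ := max (M : ℝ) 1 with hL
  have hL0 : 0 < L := lt_of_lt_of_le one_pos (le_max_right _ _)
  refine ⟨η ^ 2 / (8 * L ^ 2), by positivity, fun u H h0 hu => ?_⟩
  set S := ∑ e ∈ H, u e ^ 2 with hS
  set T := ∑ e ∈ H, u e * G.act u e with hT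
  have hS0 : 0 ≤ S := Finset.sum_nonneg fun e _ => sq_nonneg _
  set P : Finset (Σ _ : E, E) :=
    H.sigma fun e => (G.star (G.term e)).filter fun g => G.Follows e g with hP
  have hstep : ∀ p ∈ P, 1 ≤ L * G.edgeStep p.1 p.2 := by
    intro p hp
    simp only [hP, Finset.mem_sigma, Finset.mem_filter] at hp
    have h1 := one_div_le_edgeStep hM hp.2.2
    have h2 : (0 : ℝ) < M := by
      have := hM (G.term p.1)
      exact_mod_cast (show 0 < M by omega)
    calc (1 : ℝ) = M * (1 / M) := by field_simp
      _ ≤ L * G.edgeStep p.1 p.2 :=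
        mul_le_mul (le_max_left _ _) h1 (by positivity) hL0.le
  -- sums over the steps that start in `H` are bounded by expectations
  have hPsum : ∀ φ : E → E → ℝ, (∀ e g, 0 ≤ φ e g) → ∑ p ∈ P, φ p.1 p.2 ≤
      L * ∑ e ∈ H, ∑ g ∈ G.star (G.term e), G.edgeStep e g * φ e g := by
    intro φ hφ
    calc ∑ p ∈ P, φ p.1 p.2 ≤ ∑ p ∈ P, L * (G.edgeStep p.1 p.2 * φ p.1 p.2) := by
          refine Finset.sum_le_sum fun p hp => ?_
          rw [← mul_assoc]
          exact le_mul_of_one_le_left (hφ _ _) (hstep p hp)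
      _ = L * ∑ e ∈ H, ∑ g ∈ (G.star (G.term e)).filter (fun g => G.Follows e g),
            G.edgeStep e g * φ e g := by
          rw [← Finset.mul_sum, hP, Finset.sum_sigma]
      _ ≤ _ := by
          refine mul_le_mul_of_nonneg_left (Finset.sum_le_sum fun e _ => ?_) hL0.le
          exact Finset.sum_le_sum_of_subset_of_nonneg (Finset.filter_subset _ _)
            fun g _ _ => mul_nonneg (edgeStep_nonneg hdeg e g) (hφ e g)
  have hco : η * S ≤ ∑ p ∈ P, |u p.1 - u p.2| * (u p.1 + u p.2) := by
    refine (sum_le_of_isoperimetry P H (fun e => u e ^ 2) (fun A hA => hiso A P ?_)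
      (fun e => sq_nonneg _) (fun e he => by simp [hu e he])).trans
      (Finset.sum_le_sum fun p _ => max_le ?_ ?_)
    · intro p q hp _ hpq
      simp [hP, hA hp, hpq, hpq.1]
    · rw [sq_sub_sq, mul_comm]
      exact mul_le_mul_of_nonneg_right (le_abs_self _) (add_nonneg (h0 _) (h0 _))
    · exact mul_nonneg (abs_nonneg _) (add_nonneg (h0 _) (h0 _))
  have hcs := Finset.sum_mul_sq_le_sq_mul_sq P (fun p => |u p.1 - u p.2|) fun p => u p.1 + u p.2
  have hA : ∑ p ∈ P, |u p.1 - u p.2| ^ 2 ≤ L * (2 * (S - T)) := by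
    simp only [sq_abs]
    exact (hPsum (fun e g => (u e - u g) ^ 2) fun e g => sq_nonneg _).trans
      (mul_le_mul_of_nonneg_left (sum_edgeStep_mul_sq_sub_le hdeg hu) hL0.le)
  have hB : ∑ p ∈ P, (u p.1 + u p.2) ^ 2 ≤ L * (4 * S) := by
    have h1 : ∑ p ∈ P, (u p.1 + u p.2) ^ 2 ≤ ∑ p ∈ P, (2 * u p.1 ^ 2 + 2 * u p.2 ^ 2) :=
      Finset.sum_le_sum fun p _ => by nlinarith [sq_nonneg (u p.1 - u p.2)]
    refine h1.trans ((hPsum (fun e g => 2 * u e ^ 2 + 2 * u g ^ 2)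
      fun e g => by positivity).trans (mul_le_mul_of_nonneg_left ?_ hL0.le))
    have h2 : ∀ e, ∑ g ∈ G.star (G.term e), G.edgeStep e g * (2 * u e ^ 2 + 2 * u g ^ 2) =
        2 * u e ^ 2 * (∑ g ∈ G.star (G.term e), G.edgeStep e g) +
          2 * G.act (fun g => u g ^ 2) e := fun e => by
      simp only [act, Finset.mul_sum, ← Finset.sum_add_distrib]
      exact Finset.sum_congr rfl fun g _ => by ring
    simp only [h2, act_one hdeg, mul_one, Finset.sum_add_distrib, ← Finset.mul_sum]
    have h3 := sum_act_le hdeg (fun e => sq_nonneg (u e))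
      (fun e he => by rw [hu e he]; norm_num : ∀ e, e ∉ H → u e ^ 2 = 0) H
    linarith
  have hmain : (η * S) ^ 2 ≤ L * (2 * (S - T)) * (L * (4 * S)) :=
    (pow_le_pow_left₀ (by positivity) hco 2).trans (hcs.trans (mul_le_mul hA hB
      (Finset.sum_nonneg fun p _ => sq_nonneg _)
      ((Finset.sum_nonneg fun p _ => sq_nonneg _).trans hA)))
  have hST : 0 ≤ L * (2 * (S - T)) := (Finset.sum_nonneg fun p _ => sq_nonneg _).trans hA
  rcases hS0.eq_or_lt with hS' | hS'
  · rw [← hS'] at hST ⊢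
    rw [mul_zero]
    have := nonneg_of_mul_nonneg_right hST hL0
    linarith
  · have h1 : η ^ 2 * S ≤ (S - T) * (8 * L ^ 2) := by
      refine le_of_mul_le_mul_right ?_ hS'
      calc η ^ 2 * S * S = (η * S) ^ 2 := by ring
        _ ≤ _ := hmain
        _ = _ := by ring
    have h2 : η ^ 2 / (8 * L ^ 2) * S ≤ S - T := by
      rw [div_mul_eq_mul_div, div_le_iff₀ (by positivity)]
      exact h1
    linarith

lemma sum_sq_lazyAct_le {u : E → ℝ} {H : Finset E} (hu : ∀ e, e ∉ H → u e = 0) {δ : ℝ}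
    (hδ : ∑ e ∈ H, u e * G.act u e ≤ (1 - δ) * ∑ e ∈ H, u e ^ 2) :
    ∃ H' : Finset E, (∀ e, e ∉ H' → G.lazyAct u e = 0) ∧
      ∑ e ∈ H', G.lazyAct u e ^ 2 ≤ (1 - δ / 2) * ∑ e ∈ H, u e ^ 2 := by
  classical
  refine ⟨H ∪ (H.biUnion fun g => G.star (G.init g)).image G.inv, fun e he => ?_, ?_⟩
  · rw [Finset.mem_union, not_or] at he
    have h1 : G.act u e = 0 := Finset.sum_eq_zero fun g hg => by
      rw [hu g, mul_zero]
      refine fun hgH => he.2 (Finset.mem_image.2 ⟨G.inv e, Finset.mem_biUnion.2 ⟨g, hgH, ?_⟩, ?_⟩)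
      · simpa [eq_comm] using hg
      · simp
    rw [lazyAct, hu e he.1, h1]
    norm_num
  · set H' := H ∪ (H.biUnion fun g => G.star (G.init g)).image G.inv
    have hsub : H ⊆ H' := Finset.subset_union_left
    have h1 : ∑ e ∈ H', u e ^ 2 = ∑ e ∈ H, u e ^ 2 :=
      (Finset.sum_subset hsub fun e _ he => by simp [hu e he]).symm
    have h2 : ∑ e ∈ H', u e * G.act u e = ∑ e ∈ H, u e * G.act u e :=
      (Finset.sum_subset hsub fun e _ he => by simp [hu e he]).symm
    have h3 := sum_sq_act_le hdeg hu H'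
    have h4 : ∑ e ∈ H', G.lazyAct u e ^ 2 = (∑ e ∈ H', u e ^ 2 +
        2 * ∑ e ∈ H', u e * G.act u e + ∑ e ∈ H', G.act u e ^ 2) / 4 := by
      rw [Finset.mul_sum, ← Finset.sum_add_distrib, ← Finset.sum_add_distrib, Finset.sum_div]
      exact Finset.sum_congr rfl fun e _ => by rw [lazyAct]; ring
    rw [h4, h1, h2]
    linarith

lemma choose_mul_edgeProb_le (f : E) (m n : ℕ) (e : E) :
    (m.choose n : ℝ) / 2 ^ m * G.edgeProb n e f ≤
      G.lazyAct^[m] (fun g => G.edgeProb 0 g f) e := by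
  have hnn : ∀ m e, 0 ≤ G.lazyAct^[m] (fun g => G.edgeProb 0 g f) e := by
    intro m
    induction m with
    | zero => exact fun e => edgeProb_nonneg hdeg 0 e f
    | succ m ih =>
      intro e
      rw [Function.iterate_succ_apply']
      exact div_nonneg (add_nonneg (ih e) (Finset.sum_nonneg fun g _ =>
        mul_nonneg (edgeStep_nonneg hdeg e g) (ih g))) zero_le_two
  have hact : ∀ (c : ℝ) k e, G.act (fun g => c * G.edgeProb k g f) e = c * G.edgeProb (k + 1) e f :=
    fun c k e => by
      simp only [edgeProb, act, Finset.mul_sum]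
      exact Finset.sum_congr rfl fun g _ => by ring
  induction m generalizing n e with
  | zero =>
    cases n with
    | zero => simp
    | succ n => simpa using hnn 0 e
  | succ m ih =>
    rw [Function.iterate_succ_apply', lazyAct]
    cases n with
    | zero =>
      have h1 := ih 0 e
      have h2 : 0 ≤ G.act (G.lazyAct^[m] fun g => G.edgeProb 0 g f) e :=
        Finset.sum_nonneg fun g _ => mul_nonneg (edgeStep_nonneg hdeg e g) (hnn m g)
      rw [pow_succ]
      simp only [Nat.choose_zero_right] at h1 ⊢
      have h3 : ((1 : ℕ) : ℝ) / (2 ^ m * 2) * G.edgeProb 0 e f =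
          (((1 : ℕ) : ℝ) / 2 ^ m * G.edgeProb 0 e f) / 2 := by field_simp
      rw [h3]
      linarith
    | succ n =>
      have h1 := ih (n + 1) e
      have h2 := act_mono hdeg (ih n) e
      rw [hact] at h2
      rw [Nat.choose_succ_succ, pow_succ]
      push_cast
      have h3 : ((m.choose n : ℝ) + m.choose (n + 1)) / (2 ^ m * 2) * G.edgeProb (n + 1) e f =
          ((m.choose n : ℝ) / 2 ^ m * G.edgeProb (n + 1) e f +
            (m.choose (n + 1) : ℝ) / 2 ^ m * G.edgeProb (n + 1) e f) / 2 := by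
        field_simp
      rw [h3]
      linarith

omit hdeg in
/-- By comparison with the lazy chain, a spectral gap yields exponential decay. -/
lemma exists_expBounded_edgeProb {M K : ℕ} (hM : ∀ x, 2 ≤ G.deg x ∧ G.deg x ≤ M)
    (hT : ∀ e, G.Reaches K e (G.inv e)) (hG : 0 < G.isoperimetricConstant) :
    ∃ a : ℝ, 0 < a ∧ a < 1 ∧ ∀ e f, ExpBounded a fun n => G.edgeProb n e f := by
  classical
  have hdeg := fun x => (hM x).1
  obtain ⟨δ', hδ', hgap⟩ := exists_spectral_gap hM hT hG
  set δ := min δ' 1 with hδdef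
  have hδ : 0 < δ := lt_min hδ' one_pos
  have hδ1 : δ ≤ 1 := min_le_right _ _
  set q := 1 - δ / 2 with hq
  have hq0 : 0 < q := by linarith
  have hq1 : q < 1 := by linarith
  have hdecay : ∀ (f : E) (m : ℕ), ∃ H : Finset E,
      (∀ e, 0 ≤ G.lazyAct^[m] (fun g => G.edgeProb 0 g f) e) ∧
      (∀ e, e ∉ H → G.lazyAct^[m] (fun g => G.edgeProb 0 g f) e = 0) ∧
      ∑ e ∈ H, G.lazyAct^[m] (fun g => G.edgeProb 0 g f) e ^ 2 ≤ q ^ m := by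
    intro f m
    induction m with
    | zero =>
      refine ⟨{f}, fun e => edgeProb_nonneg hdeg 0 e f, fun e he => ?_, by simp [edgeProb]⟩
      simpa [edgeProb] using he
    | succ m ih =>
      obtain ⟨H, h0, hH, hs⟩ := ih
      simp only [Function.iterate_succ_apply']
      have hS0 : 0 ≤ ∑ e ∈ H, G.lazyAct^[m] (fun g => G.edgeProb 0 g f) e ^ 2 :=
        Finset.sum_nonneg fun e _ => sq_nonneg _
      obtain ⟨H', hH', hs'⟩ := sum_sq_lazyAct_le (δ := δ) hdeg hH ((hgap _ H h0 hH).trans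
        (mul_le_mul_of_nonneg_right (by linarith [min_le_left δ' 1]) hS0))
      refine ⟨H', fun e => ?_, hH', hs'.trans ?_⟩
      · exact div_nonneg (add_nonneg (h0 e) (Finset.sum_nonneg fun g _ =>
          mul_nonneg (edgeStep_nonneg hdeg e g) (h0 g))) zero_le_two
      · rw [pow_succ']
        exact mul_le_mul_of_nonneg_left hs hq0.le
  have hlazy : ∀ (f e : E) (n : ℕ), G.lazyAct^[2 * n] (fun g => G.edgeProb 0 g f) e ≤ q ^ n := by
    intro f e n
    obtain ⟨H, h0, hH, hs⟩ := hdecay f (2 * n)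
    by_cases he : e ∈ H
    · refine le_of_sq_le_sq ?_ (pow_nonneg hq0.le n)
      rw [← pow_mul, mul_comm n]
      exact (Finset.single_le_sum (f := fun e =>
        G.lazyAct^[2 * n] (fun g => G.edgeProb 0 g f) e ^ 2) (fun e _ => sq_nonneg _) he).trans hs
    · rw [hH e he]
      exact pow_nonneg hq0.le n
  have hprob : ∀ (e f : E) (n : ℕ), G.edgeProb n e f ≤ (2 * n + 1) * q ^ n := by
    intro e f n
    have h1 := (choose_mul_edgeProb_le hdeg f (2 * n) n e).trans (hlazy f e n)
    have h2 : (4 : ℝ) ^ n ≤ (2 * n + 1) * (2 * n).choose n := by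
      have h3 := Nat.four_pow_le_two_mul_add_one_mul_central_binom n
      exact_mod_cast h3
    have h4 : (2 : ℝ) ^ (2 * n) = 4 ^ n := by rw [pow_mul]; norm_num
    have h5 : (1 : ℝ) ≤ (2 * n + 1) * ((2 * n).choose n / 2 ^ (2 * n)) := by
      rw [h4, ← mul_div_assoc, one_le_div (by positivity)]
      exact h2
    calc G.edgeProb n e f
        ≤ (2 * n + 1) * ((2 * n).choose n / 2 ^ (2 * n)) * G.edgeProb n e f :=
          le_mul_of_one_le_left (edgeProb_nonneg hdeg n e f) h5
      _ = (2 * n + 1) * ((2 * n).choose n / 2 ^ (2 * n) * G.edgeProb n e f) := by ring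
      _ ≤ (2 * n + 1) * q ^ n := mul_le_mul_of_nonneg_left h1 (by positivity)
  -- by Bernoulli's inequality, `2 n + 1 ≤ C (a / q) ^ n`
  obtain ⟨a, hqa, ha1⟩ := exists_between hq1
  have ha0 := hq0.trans hqa
  set x := a / q - 1 with hx
  have hx0 : 0 < x := by rw [hx, sub_pos, one_lt_div hq0]; exact hqa
  refine ⟨a, ha0, ha1, fun e f => ⟨2 / x + 1, fun n => (hprob e f n).trans ?_⟩⟩
  have hb : 1 + n * x ≤ (a / q) ^ n := by
    have := one_add_mul_le_pow (show (-2 : ℝ) ≤ x by linarith) n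
    rwa [hx, add_sub_cancel] at this
  have hlin : (2 * n + 1 : ℝ) ≤ (2 / x + 1) * (1 + n * x) := by
    have h1 : (2 / x + 1) * (1 + n * x) = 2 * n + 1 + (2 / x + n * x) := by
      field_simp
      ring
    rw [h1]
    have : 0 ≤ 2 / x + n * x := by positivity
    linarith
  calc (2 * n + 1 : ℝ) * q ^ n ≤ (2 / x + 1) * (a / q) ^ n * q ^ n :=
        mul_le_mul_of_nonneg_right (hlin.trans (mul_le_mul_of_nonneg_left hb (by positivity)))
          (by positivity)
    _ = (2 / x + 1) * a ^ n := by
        rw [mul_assoc, ← mul_pow, div_mul_cancel₀ _ hq0.ne']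

end Gap

/-! ### Graphs that consist of one cycle -/

section AllDegreesTwo

variable (hconn : G.Connected) (h2 : ∀ x : V, G.deg x = 2) {n : ℕ} {c : ℕ → E}
  (hc : G.PeriodicCycle n c)
include hconn h2 hc

lemma amenable_of_deg_eq_two : G.Amenable := by
  classical
  have hcov := hc.exists_eq_init hconn fun k => (h2 _).le
  set F := (Finset.range n).image fun k => G.init (c k) with hF
  have hall : ∀ x, x ∈ F := fun x => by
    obtain ⟨k, rfl⟩ := hcov x
    have hp : Function.Periodic c n := hc.periodic
    rw [← hp.map_mod_nat k]
    exact Finset.mem_image_of_mem _ (Finset.mem_range.2 (Nat.mod_lt _ hc.pos))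
  have harea : G.area F = 0 := by
    rw [area_eq_card, Finset.card_eq_zero, Finset.filter_eq_empty_iff]
    exact fun e _ h => h (hall _)
  refine le_antisymm ?_ isoperimetricConstant_nonneg
  simpa [harea] using isoperimetricConstant_le (G := G) ⟨_, hall (G.init (c 0))⟩

/-- Non-backtracking walk runs around the cycle, in one of the two directions. -/
lemma nbRate_eq_one_of_deg_eq_two (x y : V) : G.nbRate x y = 1 := by
  have hdeg : ∀ x, 2 ≤ G.deg x := fun x => (h2 x).ge
  have hM : ∀ x, 2 ≤ G.deg x ∧ G.deg x ≤ 2 := fun x => ⟨hdeg x, (h2 x).le⟩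
  refine le_antisymm (nbRate_le_one hdeg x y) ?_
  by_contra! hlt
  obtain ⟨r, hr, hr1⟩ := exists_between hlt
  have hr0 := (nbRate_nonneg hdeg x y).trans_lt hr
  obtain ⟨C, hC⟩ := expBounded_of_nbRate_lt hdeg hr1.le hr
  obtain ⟨i, rfl⟩ := hc.exists_eq_init hconn (fun k => (h2 _).le) x
  obtain ⟨j, rfl⟩ := hc.exists_eq_init hconn (fun k => (h2 _).le) y
  obtain ⟨l, hl⟩ := hc.exists_pred j
  have hone : ∀ {m e f}, G.NBPath m e f → 1 ≤ G.edgeProb m e f := by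
    intro m e f h
    induction h with
    | refl e => simp [edgeProb]
    | @cons m e f g hs _ ih =>
      have h1 : G.edgeStep e f = 1 := by
        rw [edgeStep_of_follows hs, h2]; norm_num
      calc (1 : ℝ) ≤ G.edgeProb 1 e f * G.edgeProb m f g := by
            rwa [edgeProb_one, h1, one_mul]
        _ ≤ G.edgeProb (1 + m) e g := edgeProb_mul_le hdeg 1 m e f g
        _ = G.edgeProb (m + 1) e g := by rw [add_comm]
  obtain ⟨k, -, hk⟩ := hc.reaches i l
  have hturn : G.NBPath n (c i) (c i) := by
    have walk : ∀ m, G.NBPath m (c i) (c (i + m)) := fun m => by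
      induction m with
      | zero => exact .refl _
      | succ m ih => exact ih.trans (hc.follows _).nbPath
    simpa [hc.periodic i] using walk n
  have hpath : ∀ m : ℕ, ∃ N, m ≤ N ∧ G.NBPath N (c i) (c l) := fun m => by
    induction m with
    | zero => exact ⟨k, Nat.zero_le _, hk⟩
    | succ m ih =>
      obtain ⟨N, hN, hp⟩ := ih
      have := hc.pos
      exact ⟨n + N, by omega, hturn.trans hp⟩
  have hC0 : 0 < C := by
    obtain ⟨N, -, hp⟩ := hpath 0
    have h3 := edgeProb_le_nbProb hdeg N (x := G.init (c i)) (y := G.init (c j)) rfl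
      (show G.init (G.inv (c l)) = _ by rw [init_inv, ← hl, hc.init_succ])
    rw [inv_inv', h2] at h3
    have h4 := hC (N + 1)
    have h5 := hone hp
    push_cast at h3
    exact pos_of_mul_pos_left (show 0 < C * r ^ (N + 1) by linarith) (by positivity)
  obtain ⟨m, hm⟩ := exists_pow_lt_of_lt_one (show 0 < 1 / (2 * C) by positivity) hr1
  obtain ⟨N, hN, hp⟩ := hpath m
  have h3 := edgeProb_le_nbProb hdeg N (x := G.init (c i)) (y := G.init (c j)) rfl
    (show G.init (G.inv (c l)) = _ by rw [init_inv, ← hl, hc.init_succ])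
  rw [inv_inv', h2] at h3
  have h4 := hC (N + 1)
  have h5 := hone hp
  have h6 : r ^ (N + 1) < 1 / (2 * C) :=
    (pow_le_pow_of_le_one hr0.le hr1.le (show m ≤ N + 1 by omega)).trans_lt hm
  rw [lt_div_iff₀ (by positivity)] at h6
  push_cast at h3
  linarith

end AllDegreesTwo

end Multigraph

/-! ### Amenability and the non-backtracking spectral radius -/

theorem theorem1p6 {V : Type*} {E : Type*} (G : Multigraph V E) (hconn : G.Connected)
    (hcyc : G.SmallCyclesDense) (M : ℕ) (hdeg : ∀ x : V, 2 ≤ G.deg x ∧ G.deg x ≤ M) :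
    ∃ ρ : ℝ, G.IsNBSpectralRadius ρ ∧ 0 < ρ ∧ ρ ≤ 1 ∧
      (G.Amenable ↔ ρ = 1) ∧ (¬ G.Amenable ↔ G.NBDecaysExponentially) := by
  have hd := fun x => (hdeg x).1
  obtain ⟨x₀⟩ := SimpleGraph.Connected.nonempty hconn
  have : Nonempty V := ⟨x₀⟩
  have hdecay : G.NBDecaysExponentially → G.nbRate x₀ x₀ < 1 := by
    rintro ⟨a, ha0, ha1, h⟩
    exact (Multigraph.nbRate_le_of_expBounded hd ha0 (h x₀ x₀)).trans_lt ha1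
  by_cases h3 : ∃ x, 3 ≤ G.deg x
  · obtain ⟨x, hx⟩ := h3
    obtain ⟨K, hT⟩ := Multigraph.exists_reaches_inv hdeg hconn hcyc hx
    have hirr := Multigraph.exists_nbPath_of_connected hT hconn
    have hlt : G.nbRate x₀ x₀ < 1 → ¬ G.Amenable := by
      intro h
      obtain ⟨r, hr, hr1⟩ := exists_between h
      exact Multigraph.not_amenable_of_expBounded hdeg hT hirr
        ((Multigraph.nbRate_nonneg hd x₀ x₀).trans_lt hr) hr1
        (Multigraph.expBounded_edgeProb hd hirr (Multigraph.expBounded_of_nbRate_lt hd hr1.le hr))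
    have hdec : ¬ G.Amenable → G.NBDecaysExponentially := by
      intro h
      obtain ⟨a, ha0, ha1, hb⟩ := Multigraph.exists_expBounded_edgeProb hdeg hT
        (lt_of_le_of_ne Multigraph.isoperimetricConstant_nonneg (Ne.symm h))
      exact ⟨a, ha0, ha1, Multigraph.expBounded_nbProb hd ha0 hb⟩
    refine ⟨G.nbRate x₀ x₀, fun y z => le_antisymm (Multigraph.nbRate_le_nbRate hd hirr _ _ _ _)
      (Multigraph.nbRate_le_nbRate hd hirr _ _ _ _), Multigraph.nbRate_pos hd hirr _ _,
      Multigraph.nbRate_le_one hd _ _, ⟨fun h => ?_, fun h => ?_⟩, hdec, fun h => hlt (hdecay h)⟩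
    · by_contra hne
      exact hlt (lt_of_le_of_ne (Multigraph.nbRate_le_one hd _ _) hne) h
    · by_contra hna
      exact (hdecay (hdec hna)).ne h
  · push Not at h3
    have h2 : ∀ x, G.deg x = 2 := fun x => le_antisymm (Nat.le_of_lt_succ (h3 x)) (hd x)
    obtain ⟨R, -, hR⟩ := hcyc
    obtain ⟨n, c, hc, -⟩ := hR x₀
    have ham := Multigraph.amenable_of_deg_eq_two hconn h2 hc.periodicCycle
    have hrate := Multigraph.nbRate_eq_one_of_deg_eq_two hconn h2 hc.periodicCycle
    exact ⟨1, hrate, one_pos, le_rfl, ⟨fun _ => rfl, fun _ => ham⟩,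
      fun h => absurd ham h, fun h => absurd (hrate x₀ x₀) (hdecay h).ne⟩
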